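/- \textbf{Robust generalization bound for GCN.} \emph{Setting.} Fix the number of nodes $n\ge 1$, a depth $l\ge 2$ and layer widths $h_0,\dots,h_l$ with $h_k\le h$ for all $0\le k\le l$, where $h_l=K\ge 2$ is the number of classes. A sample is $z=(G,y)$, where $G=(X,A)$ consists of a feature matrix $X\in\mathbb{R}^{n\times h_0}$ and the adjacency matrix $A$ of a simple undirected graph on $n$ nodes, and $y\in\{1,\dots,K\}$. For weights $w=(W_1,\dots,W_l)$, $W_k\in\mathbb{R}^{h_{k-1}\times h_k}$, the $l$-layer ReLU GCN $f_w$ is $$H_0=X,\qquad H_k=\mathrm{ReLU}(P_G H_{k-1}W_k)\ (1\le k\le l-1),\qquad f_w(G)=\tfrac1n\mathbf 1_n H_{l-1}W_l\in\mathbb{R}^{K},$$ where $\mathbf 1_n$ is the all-ones row vector, $P_G=\tilde D^{-1/2}\tilde A\tilde D^{-1/2}$, $\tilde A=A+I$ and $\tilde D=\mathrm{diag}(\sum_j\tilde A_{ij})$. Write $\|\cdot\|_2$ for the spectral norm and $\|\cdot\|_F$ for the Frobenius norm. For $\epsilon>0$ the robust margin under the $\epsilon$-attack is $$RM(f_w(G),y)=\inf_{G'}\Big(f_w(G')_y-\max_{j\ne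 y}f_w(G')_j\Big),$$ the infimum being over all $G'=(X',A')$ with $\|X'-X\|_2\le\epsilon$ and $A'$ an arbitrary adjacency matrix on the $n$ nodes. For a distribution $\mathcal D$ on samples and $S=\{z_1,\dots,z_m\}$, $m\ge1$, with $z_i=(G_i,y_i)$, put $$R_\gamma(f_w)=\mathbb P_{(G,y)\sim\mathcal D}\{RM(f_w(G),y)\le\gamma\},\qquad \hat R_\gamma(f_w)=\frac1m\sum_{i=1}^m\mathbb 1\{RM(f_w(G_i),y_i)\le\gamma\},$$ and $$\Phi(f_w)=\prod_{i=1}^l\|W_i\|_2^2\ \sum_{i=1}^l\frac{\|W_i\|_F^2}{\|W_i\|_2^2}$$ (read as $0$ if some $W_i=0$). \emph{Theorem.} There is an absolute constant $C>0$ such that the following holds for all such $n,l,h,h_0,\dots,h_l,m$, every distribution $\mathcal D$ with $\|X\|_2\le B$ almost surely, and all $\epsilon,\gamma,\delta>0$. With probability at least $1-\delta$ over $S=\{z_1,\dots,z_m\}$ drawn i.i.d. from $\mathcal D$, for all weights $w$ simultaneously, $$R_0(f_w)\le\hat R_\gamma(f_w)+C\sqrt{\frac{(B+\epsilon)^2\,l^2\,h\log(lh)\,\Phi(f_w)+\max\{1,\gamma^2\}\log(ml/\delta)}{\gamma^2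 m}}.$$ In particular the constant and the bound do not depend on the maximum degree of the graphs. For $0<\gamma\le1$ the factor $\max\{1,\gamma^2\}$ equals $1$. -/

import Mathlib

open MeasureTheory
open scoped Matrix

noncomputable section

namespace RobustGCN

/-- The Borel sigma-algebra of `ℝ^{n × p}`, i.e. the product sigma-algebra of the entries. -/
instance matrixMeasurableSpace {n p : ℕ} : MeasurableSpace (Matrix (Fin n) (Fin p) ℝ) :=
  inferInstanceAs (MeasurableSpace (Fin n → Fin p → ℝ))

open scoped Matrix.Norms.L2Operator in
/-- Spectral norm `‖M‖₂`: the operator norm induced by the Euclidean vector norms. -/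
def specNorm {n p : ℕ} (M : Matrix (Fin n) (Fin p) ℝ) : ℝ := ‖M‖

/-- Frobenius norm `‖M‖_F`. -/
def frobNorm {n p : ℕ} (M : Matrix (Fin n) (Fin p) ℝ) : ℝ :=
  Real.sqrt (∑ i, ∑ j, M i j ^ 2)

/-- An attributed undirected graph on `n` nodes: a feature matrix in `ℝ^{n × p}` together with
the graph structure (a symmetric, zero-diagonal, 0/1 adjacency matrix, encoded as a simple
graph). -/
abbrev AttrGraph (n p : ℕ) : Type := Matrix (Fin n) (Fin p) ℝ × SimpleGraph (Fin n)

/-- A labelled sample `z = (G, y)`; labels are `Fin K`. -/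
abbrev Sample (n p K : ℕ) : Type := AttrGraph n p × Fin K

open scoped Classical in
/-- `Ã = A + I`. -/
def augAdj {n : ℕ} (A : SimpleGraph (Fin n)) : Matrix (Fin n) (Fin n) ℝ :=
  A.adjMatrix ℝ + 1

/-- The degree `D̃_i = ∑_j Ã_{ij}`, always at least `1`. -/
def augDeg {n : ℕ} (A : SimpleGraph (Fin n)) (i : Fin n) : ℝ := ∑ j, augAdj A i j

/-- The diffusion matrix `P_G = D̃^{-1/2} Ã D̃^{-1/2}`. -/
def normLaplacian {n : ℕ} (A : SimpleGraph (Fin n)) : Matrix (Fin n) (Fin n) ℝ :=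
  Matrix.diagonal (fun i => (Real.sqrt (augDeg A i))⁻¹) * augAdj A *
    Matrix.diagonal (fun i => (Real.sqrt (augDeg A i))⁻¹)

/-- Entrywise ReLU. -/
def relu {n p : ℕ} (M : Matrix (Fin n) (Fin p) ℝ) : Matrix (Fin n) (Fin p) ℝ :=
  M.map (fun x => max 0 x)

/-- Parameters of a network with `l` weight matrices and layer widths `d 0, ..., d l`
(`d 0` the input dimension, `d l` the number of classes). The matrix `W k` is the one usually
numbered `W_{k+1}`, of size `d k × d (k+1)`. -/
abbrev Weights (l : ℕ) (d : ℕ → ℕ) : Type :=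
  (k : Fin l) → Matrix (Fin (d k)) (Fin (d (k + 1))) ℝ

/-- Node representations: `H_0 = X`, `H_{k+1} = ReLU (P_G H_k W_{k+1})`. -/
def nodeRep {l n : ℕ} {d : ℕ → ℕ} (W : Weights l d) (G : AttrGraph n (d 0)) :
    (k : ℕ) → k ≤ l → Matrix (Fin n) (Fin (d k)) ℝ
  | 0, _ => G.1
  | k + 1, hk => relu (normLaplacian G.2 * nodeRep W G k (Nat.le_of_succ_le hk) * W ⟨k, hk⟩)

/-- The GCN of depth `l = L + 1` (`L` graph-convolution layers and a mean readout):
`f_w(G) = (1/n) 1_n H_{l-1} W_l`, a vector in `ℝ^{d l}`. -/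
def gcn {L n : ℕ} {d : ℕ → ℕ} (W : Weights (L + 1) d) (G : AttrGraph n (d 0)) :
    Fin (d (L + 1)) → ℝ :=
  (fun _ : Fin n => (1 / n : ℝ)) ᵥ* (nodeRep W G L (Nat.le_succ L) * W ⟨L, Nat.lt_succ_self L⟩)

/-- Margin `v_y - max_{j ≠ y} v_j` of a score vector (used for at least two classes). -/
def margin {K : ℕ} (v : Fin K → ℝ) (y : Fin K) : ℝ :=
  v y - ⨆ j : {j : Fin K // j ≠ y}, v j

/-- The adversarial samples of the `ε`-attack on `G = (X, A)`: all `(X', A')` with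
`‖X' - X‖₂ ≤ ε` and `A'` an arbitrary adjacency matrix. -/
def attackSet {n p : ℕ} (ε : ℝ) (G : AttrGraph n p) : Set (AttrGraph n p) :=
  {G' | specNorm (G'.1 - G.1) ≤ ε}

/-- Robust margin: infimum of the margin over the attack set. -/
def robustMargin {L n : ℕ} {d : ℕ → ℕ} (ε : ℝ) (W : Weights (L + 1) d)
    (z : Sample n (d 0) (d (L + 1))) : ℝ :=
  ⨅ G' : attackSet ε z.1, margin (gcn W G'.1) z.2

/-- Expected robust margin loss `R_γ(f_w)` under the data distribution `D`. -/
def robustLoss {L n : ℕ} {d : ℕ → ℕ} (D : Measure (Sample n (d 0) (d (L + 1)))) (ε γ : ℝ)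
    (W : Weights (L + 1) d) : ℝ :=
  D.real {z | robustMargin ε W z ≤ γ}

open scoped Classical in
/-- Empirical robust margin loss `R̂_γ(f_w)` on the training set `S`. -/
def empRobustLoss {L n m : ℕ} {d : ℕ → ℕ} (S : Fin m → Sample n (d 0) (d (L + 1))) (ε γ : ℝ)
    (W : Weights (L + 1) d) : ℝ :=
  (1 / m : ℝ) * ∑ i, if robustMargin ε W (S i) ≤ γ then (1 : ℝ) else 0

/-- `Φ(f_w) = ∏ ‖W_i‖₂² · ∑ ‖W_i‖_F² / ‖W_i‖₂²` (equal to `0` if some `W_i` vanishes). -/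
def Phi {l : ℕ} {d : ℕ → ℕ} (W : Weights l d) : ℝ :=
  (∏ i, specNorm (W i) ^ 2) * ∑ i, frobNorm (W i) ^ 2 / specNorm (W i) ^ 2

end RobustGCN

end

noncomputable section

namespace RobustGCN

/-! The network is positively homogeneous in each layer, so the robust margin of `W` is `s = ∏
‖W_k‖₂` times the margin at the weights normalized to spectral norm one
(`robustMargin_eq_prod_mul`). At normalized weights, changing every layer by at most `u` in spectral
norm, with `l u ≤ 1`, moves the robust margin by at most `4 l u (B + ε)`
(`abs_robustMargin_sub_le`). No degree enters, because `P_G` contracts the Frobenius norm of node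
features for every graph, and no `n` enters, because the `√n` lost between Frobenius and spectral
norm is regained in the mean readout. The attack matters only through `‖X'‖₂ ≤ B + ε`.

Consequently, if `W` has excess `a = R_0 - R̂_γ`, every network in a whole spectral neighbourhood of
the normalized weights has excess at least `a` at an intermediate threshold (`excess_le_of_near`).
Under a fixed prior such a set must be small: averaging an exponential moment over the prior and
applying Markov's inequality to the sample bounds its mass by `(m / δ) exp (-m a² / 4)`
(`exists_uniform_deviation`). For a Gaussian prior of scale `σ` it is also not too small: recentring
a symmetric set costs only `exp (-∑ ‖·‖_F² / (2 σ²))`, and all layers of a Gaussian network have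
spectral norm at most `t`, of order `√(h log (l h))`, with probability one half
(`le_stdGauss_neighbourhood`). Comparing the two bounds controls `a`.

The right radius depends on `γ / s`, hence on `W`. Dyadic scales `j` with confidence `δ / 2 ^ (j +
1)` cover all cases, and the price `j log 2` is absorbed by the factor `4 ^ j` coming from `1 / σ²`.
-/

/-! ### Exponential moments and deviation bounds under a prior. -/

lemma exp_neg_le_quadratic {s : ℝ} (hs : 0 ≤ s) : Real.exp (-s) ≤ 1 - s + s ^ 2 / 2 := by
  have h1 : 1 + s + s ^ 2 / 2 ≤ Real.exp s := Real.quadratic_le_exp_of_nonneg hs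
  have hpos : 0 < 1 + s + s ^ 2 / 2 := by positivity
  rw [Real.exp_neg]
  calc (Real.exp s)⁻¹ ≤ (1 + s + s ^ 2 / 2)⁻¹ := by gcongr
    _ ≤ 1 - s + s ^ 2 / 2 := by
      rw [inv_le_iff_one_le_mul₀ hpos]
      -- `(1 + s + s²/2) (1 - s + s²/2) = 1 + s⁴/4`.
      nlinarith [sq_nonneg (s ^ 2)]

/-- Laplace transform of a Bernoulli loss. -/
lemma integral_exp_neg_indicator_le {Z : Type*} [MeasurableSpace Z] (D : Measure Z)
    [IsProbabilityMeasure D] {A : Set Z} (hA : MeasurableSet A) {s : ℝ} (hs : 0 ≤ s) :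
    ∫ z, Real.exp (-(s * A.indicator 1 z)) ∂D ≤ Real.exp (-(s * D.real A) + s ^ 2 / 2) := by
  have hI : Integrable (A.indicator (1 : Z → ℝ)) D :=
    (integrable_const (1 : ℝ)).indicator hA
  have hint : ∫ z, A.indicator (1 : Z → ℝ) z ∂D = D.real A := integral_indicator_one hA
  calc ∫ z, Real.exp (-(s * A.indicator 1 z)) ∂D
      ≤ ∫ z, (1 - (s - s ^ 2 / 2) * A.indicator (1 : Z → ℝ) z) ∂D := by
        refine integral_mono_of_nonneg (.of_forall fun _ => (Real.exp_pos _).le)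
          ((integrable_const _).sub (hI.const_mul _)) (.of_forall fun z => ?_)
        by_cases hz : z ∈ A
        · have := exp_neg_le_quadratic hs
          simp only [hz, Set.indicator_of_mem, Pi.one_apply, mul_one]
          linarith
        · simp [hz]
    _ = 1 - (s - s ^ 2 / 2) * D.real A := by
        rw [integral_sub (integrable_const _) (hI.const_mul _), integral_const_mul, hint]
        simp
    _ ≤ Real.exp (-((s - s ^ 2 / 2) * D.real A)) := by
        have := Real.add_one_le_exp (-((s - s ^ 2 / 2) * D.real A))
        linarith
    _ ≤ _ := by
        refine Real.exp_le_exp.2 ?_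
        have : D.real A ≤ 1 := measureReal_le_one
        nlinarith [sq_nonneg s]

/-- Laplace transform of the deviation of an empirical frequency. -/
lemma integral_exp_deviation_le {Z : Type*} [MeasurableSpace Z] (D : Measure Z)
    [IsProbabilityMeasure D] {A : Set Z} (hA : MeasurableSet A) {m : ℕ} (hm : 1 ≤ m) {t : ℝ}
    (ht : 0 ≤ t) :
    ∫ S : Fin m → Z, Real.exp (t * (D.real A - (1 / m : ℝ) * ∑ i, A.indicator 1 (S i))
      - t ^ 2 / (2 * m)) ∂(Measure.pi fun _ => D) ≤ 1 := by
  have hm0 : (0 : ℝ) < m := by exact_mod_cast hm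
  have h1 : ∀ S : Fin m → Z, Real.exp (t * (D.real A - (1 / m : ℝ) * ∑ i, A.indicator 1 (S i))
      - t ^ 2 / (2 * m)) = Real.exp (t * D.real A - t ^ 2 / (2 * m)) *
        ∏ i, Real.exp (-((t / m) * A.indicator 1 (S i))) := by
    intro S
    rw [← Real.exp_sum, ← Real.exp_add, Finset.sum_neg_distrib, ← Finset.mul_sum]
    congr 1
    ring
  simp_rw [h1]
  rw [integral_const_mul, integral_fintype_prod_eq_prod
    (f := fun _ z => Real.exp (-((t / m) * A.indicator 1 z)))]
  simp only [Finset.prod_const, Finset.card_univ, Fintype.card_fin]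
  calc _ ≤ Real.exp (t * D.real A - t ^ 2 / (2 * m)) *
        Real.exp (-((t / m) * D.real A) + (t / m) ^ 2 / 2) ^ m := by
        refine mul_le_mul_of_nonneg_left (pow_le_pow_left₀
          (integral_nonneg fun z => (Real.exp_pos (-((t / m) * A.indicator 1 z))).le)
          (integral_exp_neg_indicator_le D hA (by positivity)) _) (Real.exp_pos _).le
    _ = 1 := by
        rw [← Real.exp_nat_mul, ← Real.exp_add, Real.exp_eq_one_iff]
        field_simp
        ring

/-- Change-of-measure-free PAC-Bayes bound: with high probability, the excess of the risk over the
empirical risk can be at least `a` only on a set of small prior mass. -/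
theorem exists_uniform_deviation {Ω Z : Type*} [MeasurableSpace Ω] [MeasurableSpace Z]
    (μ : Measure Ω) [IsProbabilityMeasure μ] (D : Measure Z) [IsProbabilityMeasure D]
    {A : Set (Ω × Z)} (hA : MeasurableSet A) {m : ℕ} (hm : 1 ≤ m) {δ : ℝ} (hδ : 0 < δ) :
    ∃ E : Set (Fin m → Z), MeasurableSet E ∧
      (Measure.pi fun _ : Fin m => D) Eᶜ ≤ ENNReal.ofReal δ ∧
      ∀ S ∈ E, ∀ (Q : Set Ω) (a : ℝ), 1 ≤ m * a → a ≤ 1 →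
        (∀ ω ∈ Q, a ≤ D.real {z | (ω, z) ∈ A} -
          (1 / m : ℝ) * ∑ i, {z | (ω, z) ∈ A}.indicator (1 : Z → ℝ) (S i)) →
        Real.exp (m * a ^ 2 / 4) * μ.real Q ≤ m / δ := by
  have hm0 : (0 : ℝ) < m := by exact_mod_cast hm
  set ν : Measure (Fin m → Z) := Measure.pi fun _ : Fin m => D with hν
  let F : ℕ → Ω → (Fin m → Z) → ℝ := fun k ω S =>
    Real.exp (k * (D.real {z | (ω, z) ∈ A} -
          (1 / m : ℝ) * ∑ i, A.indicator (1 : Ω × Z → ℝ) (ω, S i)) - (k : ℝ) ^ 2 / (2 * m))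
  have hFm : ∀ k, Measurable fun p : Ω × (Fin m → Z) => ENNReal.ofReal (F k p.1 p.2) := by
    intro k
    have h1 : Measurable fun ω : Ω => D.real {z | (ω, z) ∈ A} :=
      (measurable_measure_prodMk_left hA).ennreal_toReal
    have h2 : Measurable fun p : Ω × (Fin m → Z) =>
        ∑ i, A.indicator (1 : Ω × Z → ℝ) (p.1, p.2 i) := by
      refine Finset.measurable_sum _ fun i _ => ?_
      exact (measurable_one.indicator hA).comp
        (measurable_fst.prodMk ((measurable_pi_apply i).comp measurable_snd))
    refine ENNReal.measurable_ofReal.comp (Real.measurable_exp.comp ?_)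
    exact ((((h1.comp measurable_fst).sub (h2.const_mul _)).const_mul _).sub_const _)
  have hF1 : ∀ k, ∫⁻ S, ∫⁻ ω, ENNReal.ofReal (F k ω S) ∂μ ∂ν ≤ 1 := by
    intro k
    rw [lintegral_lintegral_swap (f := fun S ω => ENNReal.ofReal (F k ω S))
      ((hFm k).comp measurable_swap).aemeasurable]
    calc _ ≤ ∫⁻ _ : Ω, 1 ∂μ := by
          refine lintegral_mono fun ω => ?_
          have hAω : MeasurableSet {z | (ω, z) ∈ A} := measurable_prodMk_left hA
          have hmeas : Measurable fun S => F k ω S := by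
            have h2 : Measurable fun S : Fin m → Z =>
                ∑ i, A.indicator (1 : Ω × Z → ℝ) (ω, S i) := by
              refine Finset.measurable_sum _ fun i _ => ?_
              exact (measurable_one.indicator hA).comp
                (measurable_const.prodMk (measurable_pi_apply i))
            exact Real.measurable_exp.comp (((h2.const_mul _).const_sub _).const_mul _ |>.sub_const _)
          have hint : Integrable (F k ω) ν := by
            refine Integrable.of_bound hmeas.aestronglyMeasurable
              (Real.exp (k * 1)) (.of_forall fun S => ?_)
            rw [Real.norm_of_nonneg (Real.exp_pos _).le]
            refine Real.exp_le_exp.2 ?_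
            have h3 : D.real {z | (ω, z) ∈ A} ≤ 1 := measureReal_le_one
            have h4 : 0 ≤ (1 / m : ℝ) * ∑ i, A.indicator (1 : Ω × Z → ℝ) (ω, S i) :=
              mul_nonneg (by positivity) (Finset.sum_nonneg fun i _ =>
                Set.indicator_nonneg (fun _ _ => zero_le_one) _)
            have h5 : (0 : ℝ) ≤ (k : ℝ) ^ 2 / (2 * m) := by positivity
            have h6 : (k : ℝ) * (D.real {z | (ω, z) ∈ A} -
              (1 / m : ℝ) * ∑ i, A.indicator (1 : Ω × Z → ℝ) (ω, S i)) ≤ k * 1 := by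
              gcongr; linarith
            linarith
          rw [← ofReal_integral_eq_lintegral_ofReal hint
            (.of_forall fun S => (Real.exp_pos _).le)]
          rw [← ENNReal.ofReal_one]
          refine ENNReal.ofReal_le_ofReal ?_
          exact integral_exp_deviation_le D hAω hm (Nat.cast_nonneg k)
      _ = 1 := by simp
  have hGm : ∀ k, Measurable fun S => ∫⁻ ω, ENNReal.ofReal (F k ω S) ∂μ := fun k =>
    Measurable.lintegral_prod_left' (hFm k)
  -- The best exponent is about `m * a`, and `a` may depend on the sample. Restricting to integers
  -- `k ≤ m` leaves `m` events, whose union bound is the `m` in `m / δ`.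
  refine ⟨⋂ k ∈ Finset.Icc 1 m, {S | ∫⁻ ω, ENNReal.ofReal (F k ω S) ∂μ <
    ENNReal.ofReal (m / δ)}, ?_, ?_, ?_⟩
  · exact Finset.measurableSet_biInter _ fun k _ => measurableSet_lt (hGm k) measurable_const
  · simp only [Set.compl_iInter]
    calc _ ≤ ∑ k ∈ Finset.Icc 1 m, ν {S | ∫⁻ ω, ENNReal.ofReal (F k ω S) ∂μ <
            ENNReal.ofReal (m / δ)}ᶜ := measure_biUnion_finset_le _ _
      _ ≤ ∑ k ∈ Finset.Icc 1 m, ENNReal.ofReal (δ / m) := by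
          refine Finset.sum_le_sum fun k _ => ?_
          have h1 := mul_meas_ge_le_lintegral (μ := ν) (hGm k) (ENNReal.ofReal (m / δ))
          have h2 := h1.trans (hF1 k)
          have h3 : {S | ∫⁻ ω, ENNReal.ofReal (F k ω S) ∂μ < ENNReal.ofReal (m / δ)}ᶜ =
              {S | ENNReal.ofReal (m / δ) ≤ ∫⁻ ω, ENNReal.ofReal (F k ω S) ∂μ} := by
            ext S; simp
          rw [h3]
          have h4 : ENNReal.ofReal (δ / m) = (ENNReal.ofReal (m / δ))⁻¹ := by
            rw [← ENNReal.ofReal_inv_of_pos (by positivity), inv_div]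
          rw [h4]
          exact ENNReal.le_inv_iff_mul_le.2 (by rwa [mul_comm])
      _ = ENNReal.ofReal δ := by
          rw [Finset.sum_const, Nat.card_Icc, Nat.add_sub_cancel, nsmul_eq_mul,
            ← ENNReal.ofReal_natCast, ← ENNReal.ofReal_mul hm0.le]
          congr 1
          field_simp
  · intro S hS Q a ha ha1 hQ
    obtain ⟨k, hk⟩ : ∃ k, k = ⌊(m : ℝ) * a⌋₊ := ⟨_, rfl⟩
    have hk1 : 1 ≤ k := hk ▸ Nat.le_floor (by simpa using ha)
    have hkm : k ≤ m := by
      refine hk ▸ Nat.floor_le_of_le ?_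
      nlinarith
    have hkle : (k : ℝ) ≤ m * a := hk ▸ Nat.floor_le (by linarith)
    have hkge : (m : ℝ) * a ≤ 2 * k := by
      have := hk ▸ Nat.lt_floor_add_one ((m : ℝ) * a)
      have h1 : (1 : ℝ) ≤ (k : ℝ) := Nat.one_le_cast.2 hk1
      linarith
    have hSk : ∫⁻ ω, ENNReal.ofReal (F k ω S) ∂μ < ENNReal.ofReal (m / δ) := by
      simp only [Set.mem_iInter] at hS
      exact hS k (Finset.mem_Icc.2 ⟨hk1, hkm⟩)
    -- From `k ≤ m a` the quadratic term is at most `k a / 2`; from `m a ≤ 2 k`, which needs `1 ≤ m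
    -- a`, the remaining `k a / 2` is at least `m a² / 4`.
    have hexp : (m : ℝ) * a ^ 2 / 4 ≤ k * a - (k : ℝ) ^ 2 / (2 * m) := by
      have h1 : (k : ℝ) ^ 2 / (2 * m) ≤ k * a / 2 := by
        rw [div_le_iff₀ (by positivity)]
        nlinarith [(Nat.cast_nonneg k : (0 : ℝ) ≤ k)]
      have ha0 : 0 ≤ a := by
        by_contra h
        nlinarith
      nlinarith
    have hind : ∀ ω i, {z | (ω, z) ∈ A}.indicator (1 : Z → ℝ) (S i) =
        A.indicator (1 : Ω × Z → ℝ) (ω, S i) := by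
      intro ω i
      by_cases h : (ω, S i) ∈ A <;> simp [h]
    have hsub : Q ⊆ {ω | ENNReal.ofReal (Real.exp (m * a ^ 2 / 4)) ≤
        ENNReal.ofReal (F k ω S)} := by
      intro ω hω
      refine ENNReal.ofReal_le_ofReal (Real.exp_le_exp.2 (hexp.trans ?_))
      have h1 := hQ ω hω
      simp only [hind] at h1
      exact sub_le_sub_right (mul_le_mul_of_nonneg_left h1 (Nat.cast_nonneg k)) _
    have hm2 : Measurable fun ω => ENNReal.ofReal (F k ω S) :=
      Measurable.of_uncurry_right (f := fun ω S => ENNReal.ofReal (F k ω S)) (hFm k)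
    have h1 := (mul_meas_ge_le_lintegral (μ := μ) hm2
      (ENNReal.ofReal (Real.exp (m * a ^ 2 / 4)))).trans hSk.le
    have h2 : ENNReal.ofReal (Real.exp (m * a ^ 2 / 4)) * μ Q ≤ ENNReal.ofReal (m / δ) :=
      (mul_le_mul_right (measure_mono hsub) _).trans h1
    rw [← ENNReal.ofReal_le_ofReal_iff (by positivity), ENNReal.ofReal_mul (Real.exp_pos _).le,
      ofReal_measureReal]
    exact h2

/-- Countably many deviation bounds, with geometrically decreasing confidence, on samples all of
whose points lie in a set of full measure. -/
theorem exists_uniform_deviation_family {Ω Z : Type*} [MeasurableSpace Ω] [MeasurableSpace Z]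
    (μ : Measure Ω) [IsProbabilityMeasure μ] (D : Measure Z) [IsProbabilityMeasure D]
    {A : ℕ → Set (Ω × Z)} (hA : ∀ j, MeasurableSet (A j)) {P : Set Z} (hPm : MeasurableSet P)
    (hP : ∀ᵐ z ∂D, z ∈ P) {m : ℕ} (hm : 1 ≤ m) {δ : ℝ} (hδ : 0 < δ) :
    ∃ E : Set (Fin m → Z), MeasurableSet E ∧
      1 - δ ≤ (Measure.pi fun _ : Fin m => D).real E ∧
      ∀ S ∈ E, (∀ i, S i ∈ P) ∧ ∀ (j : ℕ) (Q : Set Ω) (a : ℝ), 1 ≤ m * a → a ≤ 1 →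
        (∀ ω ∈ Q, a ≤ D.real {z | (ω, z) ∈ A j} -
          (1 / m : ℝ) * ∑ i, {z | (ω, z) ∈ A j}.indicator (1 : Z → ℝ) (S i)) →
        Real.exp (m * a ^ 2 / 4) * μ.real Q ≤ m / (δ / 2 / 2 ^ j) := by
  choose E hEm hEμ hE using fun j : ℕ => exists_uniform_deviation μ D (hA j) hm
    (show 0 < δ / 2 / 2 ^ j by positivity)
  let E₀ : Set (Fin m → Z) := {S | ∀ i, S i ∈ P}
  have hE₀m : MeasurableSet E₀ := by
    have : E₀ = ⋂ i, (fun S : Fin m → Z => S i) ⁻¹' P := by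
      ext S
      simp [E₀]
    rw [this]
    exact MeasurableSet.iInter fun i => measurable_pi_apply i hPm
  have hE₀μ : (Measure.pi fun _ : Fin m => D) E₀ᶜ = 0 := by
    have h1 : ∀ᵐ S ∂(Measure.pi fun _ : Fin m => D), ∀ i, S i ∈ P :=
      ae_all_iff.2 fun i =>
        (measurePreserving_eval (fun _ : Fin m => D) i).quasiMeasurePreserving.ae hP
    exact h1
  have hEall : MeasurableSet (E₀ ∩ ⋂ j, E j) := hE₀m.inter (MeasurableSet.iInter hEm)
  refine ⟨E₀ ∩ ⋂ j, E j, hEall, ?_, fun S hS => ⟨hS.1, fun j => hE j S (Set.mem_iInter.1 hS.2 j)⟩⟩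
  have h1 : (Measure.pi fun _ : Fin m => D) (E₀ ∩ ⋂ j, E j)ᶜ ≤ ENNReal.ofReal δ := by
    rw [Set.compl_inter, Set.compl_iInter]
    calc _ ≤ (Measure.pi fun _ : Fin m => D) E₀ᶜ +
          ∑' j, (Measure.pi fun _ : Fin m => D) (E j)ᶜ :=
          (measure_union_le _ _).trans (add_le_add_right (measure_iUnion_le _) _)
      _ ≤ 0 + ∑' j : ℕ, ENNReal.ofReal (δ / 2 / 2 ^ j) :=
          add_le_add hE₀μ.le (ENNReal.tsum_le_tsum hEμ)
      _ = ENNReal.ofReal δ := by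
          rw [zero_add, ← ENNReal.ofReal_tsum_of_nonneg (fun j => by positivity)
            (summable_geometric_two' δ), tsum_geometric_two']
  have h2 := probReal_compl_eq_one_sub (μ := Measure.pi fun _ : Fin m => D) hEall
  have h3 : (Measure.pi fun _ : Fin m => D).real (E₀ ∩ ⋂ j, E j)ᶜ ≤ δ :=
    ENNReal.toReal_le_of_le_ofReal hδ.le h1
  linarith

/-! ### The standard Gaussian measure and translates of symmetric sets. -/

section Gaussian

variable {ι : Type*} [Fintype ι]

/-- The unnormalized standard Gaussian density. -/
def gaussKernel (x : ι → ℝ) : ENNReal := ENNReal.ofReal (Real.exp (-(∑ i, x i ^ 2) / 2))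

lemma measurable_gaussKernel : Measurable (gaussKernel : (ι → ℝ) → ENNReal) := by
  unfold gaussKernel
  fun_prop

lemma lintegral_gaussKernel_ne_top : ∫⁻ x : ι → ℝ, gaussKernel x ≠ ⊤ := by
  have h1 : Integrable (fun x : ι → ℝ => ∏ i, Real.exp (-(1 / 2) * x i ^ 2))
      (Measure.pi fun _ => volume) :=
    Integrable.fintype_prod (f := fun _ t => Real.exp (-(1 / 2) * t ^ 2))
      fun _ => integrable_exp_neg_mul_sq (by norm_num)
  have h2 : ∀ x : ι → ℝ, gaussKernel x = ENNReal.ofReal (∏ i, Real.exp (-(1 / 2) * x i ^ 2)) := by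
    intro x
    rw [← Real.exp_sum, ← Finset.mul_sum, gaussKernel]
    congr 2
    ring
  simp_rw [h2]
  exact h1.lintegral_lt_top.ne

lemma lintegral_gaussKernel_ne_zero : ∫⁻ x : ι → ℝ, gaussKernel x ≠ 0 := by
  rw [Ne, lintegral_eq_zero_iff measurable_gaussKernel]
  intro h
  have h1 : ∀ᵐ _x : ι → ℝ, False := by
    filter_upwards [h] with x hx
    have : 0 < gaussKernel x := ENNReal.ofReal_pos.2 (Real.exp_pos _)
    exact this.ne' hx
  simp only [Filter.eventually_false_iff_eq_bot, ae_eq_bot] at h1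
  exact NeZero.ne (volume : Measure (ι → ℝ)) h1

variable (ι) in
/-- The standard Gaussian measure on `ι → ℝ`. -/
def stdGauss : Measure (ι → ℝ) :=
  (∫⁻ x : ι → ℝ, gaussKernel x)⁻¹ • (volume : Measure (ι → ℝ)).withDensity gaussKernel

lemma lintegral_stdGauss {g : (ι → ℝ) → ENNReal} (hg : Measurable g) :
    ∫⁻ x, g x ∂(stdGauss ι) =
      (∫⁻ x : ι → ℝ, gaussKernel x)⁻¹ * ∫⁻ x, gaussKernel x * g x := by
  rw [stdGauss, lintegral_smul_measure, lintegral_withDensity_eq_lintegral_mul _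
    measurable_gaussKernel hg, smul_eq_mul]
  rfl

instance : IsProbabilityMeasure (stdGauss ι) := by
  constructor
  rw [← lintegral_one, lintegral_stdGauss measurable_const]
  simp only [mul_one]
  exact ENNReal.inv_mul_cancel lintegral_gaussKernel_ne_zero lintegral_gaussKernel_ne_top

lemma gaussKernel_add (x w : ι → ℝ) :
    gaussKernel (x + w) = gaussKernel x *
      ENNReal.ofReal (Real.exp (-(∑ i, w i * x i) - (∑ i, w i ^ 2) / 2)) := by
  unfold gaussKernel
  rw [← ENNReal.ofReal_mul (Real.exp_pos _).le, ← Real.exp_add]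
  congr 2
  have : ∑ i, (x + w) i ^ 2 = ∑ i, x i ^ 2 + 2 * ∑ i, w i * x i + ∑ i, w i ^ 2 := by
    rw [Finset.mul_sum, ← Finset.sum_add_distrib, ← Finset.sum_add_distrib]
    refine Finset.sum_congr rfl fun i _ => ?_
    simp only [Pi.add_apply]
    ring
  rw [this]
  ring

/-- Laplace transform of the standard Gaussian measure. -/
lemma lintegral_exp_stdGauss (a : ι → ℝ) :
    ∫⁻ x, ENNReal.ofReal (Real.exp (∑ i, a i * x i)) ∂(stdGauss ι) =
      ENNReal.ofReal (Real.exp ((∑ i, a i ^ 2) / 2)) := by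
  rw [lintegral_stdGauss (by fun_prop)]
  have h1 : ∀ x : ι → ℝ, gaussKernel x * ENNReal.ofReal (Real.exp (∑ i, a i * x i)) =
      ENNReal.ofReal (Real.exp ((∑ i, a i ^ 2) / 2)) * gaussKernel (x + -a) := by
    intro x
    rw [gaussKernel_add, mul_left_comm, ← ENNReal.ofReal_mul (Real.exp_pos _).le,
      ← Real.exp_add]
    congr 3
    simp
  simp_rw [h1]
  rw [lintegral_const_mul _ (f := fun x => gaussKernel (x + -a))
      (measurable_gaussKernel.comp (measurable_add_const _)),
    lintegral_add_right_eq_self (fun x => gaussKernel x), mul_left_comm,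
    ENNReal.inv_mul_cancel lintegral_gaussKernel_ne_zero lintegral_gaussKernel_ne_top, mul_one]

/-- The Gaussian mass of a translate of a symmetric set. -/
lemma le_stdGauss_translate (w : ι → ℝ) {G : Set (ι → ℝ)} (hG : MeasurableSet G)
    (hsymm : ∀ x ∈ G, -x ∈ G) :
    ENNReal.ofReal (Real.exp (-(∑ i, w i ^ 2) / 2)) * stdGauss ι G ≤
      stdGauss ι {x | x - w ∈ G} := by
  have hG' : MeasurableSet {x : ι → ℝ | x - w ∈ G} := hG.preimage (measurable_sub_const w)
  have hneg : ∀ x, -x ∈ G ↔ x ∈ G := fun x => ⟨fun h => by simpa using hsymm _ h, hsymm x⟩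
  rw [← lintegral_indicator_one hG, ← lintegral_indicator_one hG',
    lintegral_stdGauss (measurable_one.indicator hG),
    lintegral_stdGauss (measurable_one.indicator hG'), mul_left_comm]
  refine mul_le_mul_right ?_ _
  rw [← lintegral_add_right_eq_self
    (fun x => gaussKernel x * {x | x - w ∈ G}.indicator (1 : (ι → ℝ) → ENNReal) x) w]
  let K : (ι → ℝ) → ENNReal := fun x => gaussKernel x * G.indicator 1 x
  let e : (ι → ℝ) → ENNReal := fun x => ENNReal.ofReal (Real.exp (∑ i, w i * x i))
  let c : ENNReal := ENNReal.ofReal (Real.exp (-(∑ i, w i ^ 2) / 2))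
  have hK : Measurable K := measurable_gaussKernel.mul (measurable_one.indicator hG)
  have he : Measurable e := by fun_prop
  have h1 : ∀ x, gaussKernel (x + w) *
      {x | x - w ∈ G}.indicator (1 : (ι → ℝ) → ENNReal) (x + w) = c * (K x * e (-x)) := by
    intro x
    have h2 : {x | x - w ∈ G}.indicator (1 : (ι → ℝ) → ENNReal) (x + w) =
        G.indicator 1 x := by
      by_cases hx : x ∈ G <;> simp [hx]
    have h3 : ENNReal.ofReal (Real.exp (-(∑ i, w i * x i) - (∑ i, w i ^ 2) / 2)) =
        c * e (-x) := by
      simp only [c, e]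
      rw [← ENNReal.ofReal_mul (Real.exp_pos _).le, ← Real.exp_add]
      congr 2
      simp only [Pi.neg_apply, mul_neg, Finset.sum_neg_distrib]
      ring
    rw [h2, gaussKernel_add, h3]
    simp only [K]
    ring
  simp_rw [h1]
  rw [lintegral_const_mul _ (f := fun x => K x * e (-x)) (hK.mul (he.comp measurable_neg))]
  refine mul_le_mul_right ?_ _
  -- Symmetry of `G` makes `K` even, so the factor `exp (-⟨w, x⟩)` may be averaged with its
  -- reflection; `exp r + exp (-r) ≥ 2` then removes it.
  have h4 : ∫⁻ x, K x * e (-x) = ∫⁻ x, K x * e x := by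
    rw [← lintegral_neg_eq_self (fun x => K x * e x)]
    refine lintegral_congr fun x => ?_
    congr 1
    simp only [K, gaussKernel, Pi.neg_apply, neg_sq]
    by_cases hx : x ∈ G
    · simp [hx, (hneg x).2 hx]
    · simp [hx, mt (hneg x).1 hx]
  have h5 : 2 * ∫⁻ x, K x ≤ 2 * ∫⁻ x, K x * e (-x) := by
    calc 2 * ∫⁻ x, K x = ∫⁻ x, 2 * K x := (lintegral_const_mul _ hK).symm
      _ ≤ ∫⁻ x, (K x * e (-x) + K x * e x) := by
        refine lintegral_mono fun x => ?_
        rw [← mul_add, mul_comm]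
        refine mul_le_mul_right ?_ _
        simp only [e]
        rw [← ENNReal.ofReal_add (Real.exp_pos _).le (Real.exp_pos _).le]
        have : (2 : ENNReal) = ENNReal.ofReal 2 := by simp
        rw [this]
        refine ENNReal.ofReal_le_ofReal ?_
        simp only [Pi.neg_apply, mul_neg, Finset.sum_neg_distrib]
        have := Real.add_one_le_exp (-(∑ i, w i * x i))
        have := Real.add_one_le_exp (∑ i, w i * x i)
        linarith
      _ = 2 * ∫⁻ x, K x * e (-x) := by
        rw [lintegral_add_right (fun x => K x * e (-x)) (g := fun x => K x * e x) (hK.mul he),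
          ← h4, two_mul]
  exact (ENNReal.mul_le_mul_iff_right (by simp) (by simp)).1 h5

end Gaussian

/-! ### Spectral norm tail of a Gaussian matrix. -/

section SpectralTail

/-- A bounded operator is large, as a bilinear form, on a product of two balls of radius `1/8`. -/
lemma exists_balls_norm_le_inner {E F : Type*} [NormedAddCommGroup E] [InnerProductSpace ℝ E]
    [NormedAddCommGroup F] [InnerProductSpace ℝ F] (T : E →L[ℝ] F) (hT : 0 < ‖T‖) :
    ∃ x₀ : E, ∃ y₀ : F, Metric.ball x₀ (1 / 8) ⊆ Metric.ball 0 1 ∧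
      Metric.ball y₀ (1 / 8) ⊆ Metric.ball 0 1 ∧
      ∀ x ∈ Metric.ball x₀ (1 / 8), ∀ y ∈ Metric.ball y₀ (1 / 8), ‖T‖ / 4 ≤ inner ℝ y (T x) := by
  -- The norm need not be attained. With centres shrunk by `7/8`, the main term `49/64 * 15/16`
  -- minus the cross terms `7/64 + 7/64 + 1/64` still exceeds `1/4`.
  obtain ⟨u, hu, hTu⟩ := T.exists_lt_apply_of_lt_opNorm (r := 15 / 16 * ‖T‖) (by linarith)
  have hTu0 : 0 < ‖T u‖ := by linarith
  set v : F := ‖T u‖⁻¹ • T u with hv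
  have hvn : ‖v‖ = 1 := by
    rw [hv, norm_smul, norm_inv, norm_norm, inv_mul_cancel₀ hTu0.ne']
  have hvu : inner ℝ v (T u) = ‖T u‖ := by
    rw [hv, real_inner_smul_left, real_inner_self_eq_norm_sq]
    field_simp
  have hx0 : ‖(7 / 8 : ℝ) • u‖ ≤ 7 / 8 := by
    rw [norm_smul, Real.norm_of_nonneg (by norm_num)]
    linarith
  have hy0 : ‖(7 / 8 : ℝ) • v‖ ≤ 7 / 8 := by
    rw [norm_smul, Real.norm_of_nonneg (by norm_num), hvn]
    norm_num
  refine ⟨(7 / 8 : ℝ) • u, (7 / 8 : ℝ) • v, ?_, ?_, ?_⟩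
  · refine Metric.ball_subset_ball' ?_
    rw [dist_zero_right]
    linarith
  · refine Metric.ball_subset_ball' ?_
    rw [dist_zero_right]
    linarith
  · intro x hx y hy
    rw [mem_ball_iff_norm] at hx hy
    obtain ⟨a, rfl⟩ : ∃ a, x = (7 / 8 : ℝ) • u + a := ⟨x - (7 / 8 : ℝ) • u, by abel⟩
    obtain ⟨b, rfl⟩ : ∃ b, y = (7 / 8 : ℝ) • v + b := ⟨y - (7 / 8 : ℝ) • v, by abel⟩
    rw [add_sub_cancel_left] at hx hy
    have hbound : ∀ (y : F) (x : E) (α β : ℝ), 0 ≤ α → ‖y‖ ≤ α → ‖x‖ ≤ β →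
        -(α * (‖T‖ * β)) ≤ inner ℝ y (T x) := by
      intro y x α β hα hy hx
      refine neg_le_of_abs_le ((abs_real_inner_le_norm _ _).trans ?_)
      have := T.le_opNorm x
      gcongr
      exact this.trans (by gcongr)
    have e1 := hbound ((7 / 8 : ℝ) • v) a (7 / 8) (1 / 8) (by norm_num) hy0 hx.le
    have e2 := hbound b ((7 / 8 : ℝ) • u) (1 / 8) (7 / 8) (by norm_num) hy.le hx0
    have e3 := hbound b a (1 / 8) (1 / 8) (by norm_num) hy.le hx.le
    have e4 : inner ℝ ((7 / 8 : ℝ) • v) (T ((7 / 8 : ℝ) • u)) = 49 / 64 * ‖T u‖ := by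
      rw [map_smul, real_inner_smul_left, real_inner_smul_right, hvu]
      ring
    rw [map_add, inner_add_left, inner_add_right, inner_add_right, e4]
    linarith

variable {ι : Type*} {p q : ℕ}

/-- The matrix formed by the coordinates of `ω` selected by `e`. -/
def coordMatrix (e : Fin p × Fin q → ι) (ω : ι → ℝ) : Matrix (Fin p) (Fin q) ℝ :=
  fun i j => ω (e (i, j))

lemma continuous_coordMatrix (e : Fin p × Fin q → ι) : Continuous (coordMatrix e) :=
  continuous_pi fun _ => continuous_pi fun _ => continuous_apply _

open scoped Matrix.Norms.L2Operator in
lemma continuous_specNorm : Continuous (specNorm : Matrix (Fin p) (Fin q) ℝ → ℝ) :=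
  continuous_norm

open scoped Matrix.Norms.L2Operator in
lemma specNorm_eq_opNorm (M : Matrix (Fin p) (Fin q) ℝ) :
    specNorm M = ‖LinearMap.toContinuousLinearMap (Matrix.toEuclideanLin M)‖ :=
  Matrix.l2_opNorm_def M

lemma specNorm_nonneg (M : Matrix (Fin p) (Fin q) ℝ) : 0 ≤ specNorm M := by
  rw [specNorm_eq_opNorm]
  exact norm_nonneg _

lemma inner_toEuclideanLin (M : Matrix (Fin p) (Fin q) ℝ) (x : EuclideanSpace ℝ (Fin q))
    (y : EuclideanSpace ℝ (Fin p)) :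
    inner ℝ y (Matrix.toEuclideanLin M x) = ∑ ij : Fin p × Fin q, y ij.1 * x ij.2 * M ij.1 ij.2 := by
  rw [PiLp.inner_apply, Fintype.sum_prod_type]
  refine Finset.sum_congr rfl fun i _ => ?_
  simp only [RCLike.inner_apply, conj_trivial, Matrix.toLpLin_apply, Matrix.mulVec, dotProduct]
  rw [Finset.sum_mul]
  exact Finset.sum_congr rfl fun j _ => by ring

/-- The exponent is a linear form in `ω` whose coefficient vector, extended by zero off the range of
`e`, has Euclidean norm `|θ| ‖x‖ ‖y‖ ≤ |θ|`. -/
lemma lintegral_exp_bilinear_le [Fintype ι] (e : Fin p × Fin q → ι) (he : Function.Injective e) (θ : ℝ)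
    {x : EuclideanSpace ℝ (Fin q)} {y : EuclideanSpace ℝ (Fin p)} (hx : ‖x‖ ≤ 1) (hy : ‖y‖ ≤ 1) :
    ∫⁻ ω, ENNReal.ofReal (Real.exp (θ * ∑ ij : Fin p × Fin q,
        y ij.1 * x ij.2 * coordMatrix e ω ij.1 ij.2)) ∂(stdGauss ι) ≤
      ENNReal.ofReal (Real.exp (θ ^ 2 / 2)) := by
  let c : ι → ℝ := Function.extend e (fun ij => θ * (y ij.1 * x ij.2)) 0
  have hc : ∀ ij, c (e ij) = θ * (y ij.1 * x ij.2) := fun ij => he.extend_apply _ _ _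
  have hc0 : ∀ a ∉ Set.range e, c a = 0 := fun a ha =>
    Function.extend_apply' _ _ _ fun ⟨b, hb⟩ => ha ⟨b, hb⟩
  have h1 : ∀ ω : ι → ℝ, θ * ∑ ij : Fin p × Fin q, y ij.1 * x ij.2 * coordMatrix e ω ij.1 ij.2 =
      ∑ a, c a * ω a := by
    intro ω
    rw [Finset.mul_sum]
    refine Fintype.sum_of_injective e he _ _ (fun a ha => by rw [hc0 a ha, zero_mul]) fun ij => ?_
    rw [hc, coordMatrix]
    ring
  have h2 : ∑ a, c a ^ 2 = θ ^ 2 * (‖y‖ ^ 2 * ‖x‖ ^ 2) := by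
    rw [← Fintype.sum_of_injective e he (fun ij => (θ * (y ij.1 * x ij.2)) ^ 2) (fun a => c a ^ 2)
      (fun a ha => by simp [hc0 a ha]) fun ij => by rw [hc], EuclideanSpace.real_norm_sq_eq,
      EuclideanSpace.real_norm_sq_eq, Finset.sum_mul_sum, Fintype.sum_prod_type, Finset.mul_sum]
    refine Finset.sum_congr rfl fun i _ => ?_
    rw [Finset.mul_sum]
    exact Finset.sum_congr rfl fun j _ => by ring
  simp_rw [h1]
  rw [lintegral_exp_stdGauss, h2]
  refine ENNReal.ofReal_le_ofReal (Real.exp_le_exp.2 ?_)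
  have h3 : ‖y‖ ^ 2 * ‖x‖ ^ 2 ≤ 1 :=
    mul_le_one₀ (pow_le_one₀ (norm_nonneg _) hy) (by positivity) (pow_le_one₀ (norm_nonneg _) hx)
  nlinarith [sq_nonneg θ]

/-- A volume argument in place of a net: the exponential moment of `⟨y, M x⟩` is integrated over
pairs in the unit balls. When `‖M‖₂ > t` the form exceeds `t / 4` on a product of balls occupying a
fraction `8 ^ (-(p + q))` of the volume. The parameter `θ = t / 4` minimizes `θ² / 2 - θ t / 4`,
giving `-t² / 32`. -/
lemma stdGauss_specNorm_gt_le [Fintype ι] (e : Fin p × Fin q → ι) (he : Function.Injective e) {t : ℝ}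
    (ht : 0 < t) :
    stdGauss ι {ω | t < specNorm (coordMatrix e ω)} ≤
      ENNReal.ofReal (8 ^ (p + q) * Real.exp (-(t ^ 2 / 32))) := by
  let Bx : Set (EuclideanSpace ℝ (Fin q)) := Metric.ball 0 1
  let By : Set (EuclideanSpace ℝ (Fin p)) := Metric.ball 0 1
  let vol : Measure (EuclideanSpace ℝ (Fin q) × EuclideanSpace ℝ (Fin p)) := volume.prod volume
  let f : (ι → ℝ) → EuclideanSpace ℝ (Fin q) × EuclideanSpace ℝ (Fin p) → ENNReal := fun ω z =>
    ENNReal.ofReal (Real.exp (t / 4 * ∑ ij : Fin p × Fin q,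
      z.2 ij.1 * z.1 ij.2 * coordMatrix e ω ij.1 ij.2))
  have hf : Measurable (Function.uncurry f) := by
    refine ENNReal.measurable_ofReal.comp (Continuous.measurable ?_)
    simp only [coordMatrix]
    fun_prop
  set N : ENNReal := volume Bx * volume By with hN
  have hN0 : N ≠ 0 := mul_ne_zero (Metric.measure_ball_pos _ _ one_pos).ne'
    (Metric.measure_ball_pos _ _ one_pos).ne'
  have hNt : N ≠ ⊤ := ENNReal.mul_ne_top measure_ball_lt_top.ne measure_ball_lt_top.ne
  have hB : MeasurableSet (Bx ×ˢ By) := measurableSet_ball.prod measurableSet_ball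
  have hup : ∫⁻ ω, ∫⁻ z in Bx ×ˢ By, f ω z ∂vol ∂(stdGauss ι) ≤
      ENNReal.ofReal (Real.exp ((t / 4) ^ 2 / 2)) * N := by
    rw [lintegral_lintegral_swap hf.aemeasurable]
    calc _ ≤ ∫⁻ z in Bx ×ˢ By, ENNReal.ofReal (Real.exp ((t / 4) ^ 2 / 2)) ∂vol := by
          refine setLIntegral_mono' hB fun z hz => ?_
          exact lintegral_exp_bilinear_le e he (t / 4)
            (mem_ball_zero_iff.1 hz.1).le (mem_ball_zero_iff.1 hz.2).le
      _ = _ := by rw [setLIntegral_const, Measure.prod_prod]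
  have hlow : ∀ ω ∈ {ω | t < specNorm (coordMatrix e ω)},
      ENNReal.ofReal (Real.exp (t / 4 * (t / 4)) * (1 / 8) ^ (p + q)) * N ≤
        ∫⁻ z in Bx ×ˢ By, f ω z ∂vol := by
    intro ω hω
    have hω' : t < specNorm (coordMatrix e ω) := hω
    rw [specNorm_eq_opNorm] at hω'
    obtain ⟨x₀, y₀, hx₀, hy₀, hxy⟩ := exists_balls_norm_le_inner _ (ht.trans hω')
    have hsub : Metric.ball x₀ (1 / 8) ×ˢ Metric.ball y₀ (1 / 8) ⊆ Bx ×ˢ By :=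
      Set.prod_mono hx₀ hy₀
    calc _ = ∫⁻ z in Metric.ball x₀ (1 / 8) ×ˢ Metric.ball y₀ (1 / 8),
          ENNReal.ofReal (Real.exp (t / 4 * (t / 4))) ∂vol := by
          rw [setLIntegral_const, Measure.prod_prod,
            Measure.addHaar_ball_of_pos _ _ (by norm_num : (0 : ℝ) < 1 / 8),
            Measure.addHaar_ball_of_pos _ _ (by norm_num : (0 : ℝ) < 1 / 8),
            ENNReal.ofReal_mul (Real.exp_pos _).le, pow_add, ENNReal.ofReal_mul (by positivity)]
          simp only [finrank_euclideanSpace, Fintype.card_fin, hN, Bx, By]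
          ring
      _ ≤ ∫⁻ z in Metric.ball x₀ (1 / 8) ×ˢ Metric.ball y₀ (1 / 8), f ω z ∂vol := by
          refine setLIntegral_mono' (measurableSet_ball.prod measurableSet_ball) fun z hz => ?_
          refine ENNReal.ofReal_le_ofReal (Real.exp_le_exp.2 ?_)
          refine mul_le_mul_of_nonneg_left ?_ (by positivity)
          rw [← inner_toEuclideanLin]
          have := hxy z.1 hz.1 z.2 hz.2
          rw [LinearMap.coe_toContinuousLinearMap'] at this
          linarith
      _ ≤ _ := lintegral_mono_set hsub
  set c : ℝ := Real.exp (t / 4 * (t / 4)) * (1 / 8) ^ (p + q) with hc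
  have hc0 : 0 < c := by positivity
  have hmeas : Measurable fun ω => ∫⁻ z in Bx ×ˢ By, f ω z ∂vol :=
    Measurable.lintegral_prod_right' hf
  have h1 : ENNReal.ofReal c * N * stdGauss ι {ω | t < specNorm (coordMatrix e ω)} ≤
      ENNReal.ofReal (Real.exp ((t / 4) ^ 2 / 2)) * N :=
    (mul_le_mul_right (measure_mono hlow) _).trans
      ((mul_meas_ge_le_lintegral hmeas _).trans hup)
  rw [mul_right_comm] at h1
  have h2 := (ENNReal.mul_le_mul_iff_left hN0 hNt).1 h1
  have h3 : stdGauss ι {ω | t < specNorm (coordMatrix e ω)} ≤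
      ENNReal.ofReal (Real.exp ((t / 4) ^ 2 / 2)) / ENNReal.ofReal c := by
    rw [ENNReal.le_div_iff_mul_le (Or.inl (ENNReal.ofReal_pos.2 hc0).ne')
      (Or.inl ENNReal.ofReal_ne_top), mul_comm]
    exact h2
  refine h3.trans (le_of_eq ?_)
  rw [← ENNReal.ofReal_div_of_pos hc0, hc]
  congr 1
  have h4 : Real.exp ((t / 4) ^ 2 / 2) = Real.exp (t / 4 * (t / 4)) * Real.exp (-(t ^ 2 / 32)) := by
    rw [← Real.exp_add]
    congr 1
    ring
  rw [h4, one_div, inv_pow]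
  field_simp

end SpectralTail

/-! ### Frobenius and spectral norms, ReLU, diffusion and readout. -/

section Norms

variable {m n p q : ℕ}

lemma frobNorm_nonneg (M : Matrix (Fin n) (Fin p) ℝ) : 0 ≤ frobNorm M := Real.sqrt_nonneg _

lemma frobNorm_sq (M : Matrix (Fin n) (Fin p) ℝ) : frobNorm M ^ 2 = ∑ i, ∑ j, M i j ^ 2 :=
  Real.sq_sqrt (Finset.sum_nonneg fun _ _ => Finset.sum_nonneg fun _ _ => sq_nonneg _)

open scoped Matrix.Norms.Frobenius in
lemma frobNorm_eq_norm (M : Matrix (Fin n) (Fin p) ℝ) : frobNorm M = ‖M‖ := by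
  rw [Matrix.frobenius_norm_def, frobNorm, Real.sqrt_eq_rpow]
  simp

open scoped Matrix.Norms.Frobenius in
lemma frobNorm_add_le (M N : Matrix (Fin n) (Fin p) ℝ) :
    frobNorm (M + N) ≤ frobNorm M + frobNorm N := by
  simp only [frobNorm_eq_norm]
  exact norm_add_le M N

open scoped Matrix.Norms.L2Operator in
lemma specNorm_add_le (M N : Matrix (Fin n) (Fin p) ℝ) :
    specNorm (M + N) ≤ specNorm M + specNorm N :=
  norm_add_le M N

open scoped Matrix.Norms.L2Operator in
lemma specNorm_smul (c : ℝ) (M : Matrix (Fin n) (Fin p) ℝ) :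
    specNorm (c • M) = |c| * specNorm M :=
  norm_smul c M

open scoped Matrix.Norms.L2Operator in
lemma specNorm_zero : specNorm (0 : Matrix (Fin n) (Fin p) ℝ) = 0 :=
  norm_zero

open scoped Matrix.Norms.L2Operator in
lemma eq_zero_of_specNorm_eq_zero {M : Matrix (Fin n) (Fin p) ℝ} (h : specNorm M = 0) : M = 0 :=
  norm_eq_zero.1 h

lemma frobNorm_smul_sq (c : ℝ) (M : Matrix (Fin n) (Fin p) ℝ) :
    frobNorm (c • M) ^ 2 = c ^ 2 * frobNorm M ^ 2 := by
  rw [frobNorm_sq, frobNorm_sq, Finset.mul_sum]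
  refine Finset.sum_congr rfl fun i _ => ?_
  rw [Finset.mul_sum]
  exact Finset.sum_congr rfl fun j _ => by rw [Matrix.smul_apply, smul_eq_mul, mul_pow]

open scoped Matrix.Norms.L2Operator in
-- Each row of `M * N` is `Nᵀ` applied to the corresponding row of `M`.
lemma frobNorm_mul_le (M : Matrix (Fin m) (Fin n) ℝ) (N : Matrix (Fin n) (Fin p) ℝ) :
    frobNorm (M * N) ≤ frobNorm M * specNorm N := by
  refine abs_le_of_sq_le_sq' ?_ (mul_nonneg (frobNorm_nonneg _) (specNorm_nonneg _)) |>.2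
  rw [mul_pow, frobNorm_sq, frobNorm_sq, Finset.sum_mul]
  refine Finset.sum_le_sum fun i _ => ?_
  have h1 := Matrix.l2_opNorm_mulVec Nᵀ (WithLp.toLp 2 (M i))
  have h2 : ‖Nᵀ‖ = specNorm N := by
    rw [← Matrix.conjTranspose_eq_transpose_of_trivial, Matrix.l2_opNorm_conjTranspose]
    rfl
  rw [h2] at h1
  have h3 := pow_le_pow_left₀ (norm_nonneg _) h1 2
  rw [mul_pow, EuclideanSpace.real_norm_sq_eq, EuclideanSpace.real_norm_sq_eq] at h3
  have h4 : ∀ j, (M * N) i j = (Nᵀ *ᵥ M i) j := by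
    intro j
    rw [Matrix.mulVec_transpose]
    rfl
  simp_rw [h4]
  rw [mul_comm]
  exact h3

lemma frobNorm_one : frobNorm (1 : Matrix (Fin n) (Fin n) ℝ) = Real.sqrt n := by
  rw [frobNorm]
  congr 1
  simp [Matrix.one_apply]

lemma frobNorm_le_sqrt_mul_specNorm (M : Matrix (Fin n) (Fin p) ℝ) :
    frobNorm M ≤ Real.sqrt n * specNorm M := by
  have := frobNorm_mul_le (1 : Matrix (Fin n) (Fin n) ℝ) M
  rwa [Matrix.one_mul, frobNorm_one] at this

lemma specNorm_le_frobNorm (M : Matrix (Fin n) (Fin p) ℝ) : specNorm M ≤ frobNorm M := by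
  rw [specNorm_eq_opNorm]
  refine ContinuousLinearMap.opNorm_le_bound _ (frobNorm_nonneg _) fun x => ?_
  refine abs_le_of_sq_le_sq' ?_ (mul_nonneg (frobNorm_nonneg _) (norm_nonneg _)) |>.2
  rw [mul_pow, frobNorm_sq, EuclideanSpace.real_norm_sq_eq, EuclideanSpace.real_norm_sq_eq,
    Finset.sum_mul]
  refine Finset.sum_le_sum fun i _ => ?_
  simp only [LinearMap.coe_toContinuousLinearMap', Matrix.toLpLin_apply, Matrix.mulVec, dotProduct]
  exact Finset.sum_mul_sq_le_sq_mul_sq _ _ _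

lemma frobNorm_relu_sub_le (M N : Matrix (Fin n) (Fin p) ℝ) :
    frobNorm (relu M - relu N) ≤ frobNorm (M - N) := by
  refine Real.sqrt_le_sqrt (Finset.sum_le_sum fun i _ => Finset.sum_le_sum fun j _ => ?_)
  rw [sq_le_sq]
  simp only [relu, Matrix.sub_apply, Matrix.map_apply]
  rw [max_comm 0, max_comm 0]
  exact abs_max_sub_max_le_abs (M i j) (N i j) 0

lemma frobNorm_relu_le (M : Matrix (Fin n) (Fin p) ℝ) : frobNorm (relu M) ≤ frobNorm M := by
  have h : relu (0 : Matrix (Fin n) (Fin p) ℝ) = 0 := by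
    ext i j
    simp [relu]
  simpa [h] using frobNorm_relu_sub_le M 0

lemma relu_smul {c : ℝ} (hc : 0 ≤ c) (M : Matrix (Fin n) (Fin p) ℝ) :
    relu (c • M) = c • relu M := by
  ext i j
  simp only [relu, Matrix.map_apply, Matrix.smul_apply, smul_eq_mul]
  rw [mul_max_of_nonneg _ _ hc, mul_zero]

lemma augAdj_nonneg (A : SimpleGraph (Fin n)) (i j : Fin n) : 0 ≤ augAdj A i j := by
  classical
  simp only [augAdj, Matrix.add_apply, SimpleGraph.adjMatrix_apply, Matrix.one_apply]
  split_ifs <;> norm_num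

lemma augAdj_symm (A : SimpleGraph (Fin n)) (i j : Fin n) : augAdj A i j = augAdj A j i := by
  classical
  simp only [augAdj, Matrix.add_apply, SimpleGraph.adjMatrix_apply, Matrix.one_apply, A.adj_comm,
    eq_comm]

lemma augDeg_pos (A : SimpleGraph (Fin n)) (i : Fin n) : 0 < augDeg A i := by
  refine Finset.sum_pos' (fun j _ => augAdj_nonneg A i j) ⟨i, Finset.mem_univ i, ?_⟩
  simp [augAdj]

/-- The normalized diffusion matrix is a contraction. -/
lemma frobNorm_normLaplacian_mul_le (A : SimpleGraph (Fin n)) (M : Matrix (Fin n) (Fin p) ℝ) :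
    frobNorm (normLaplacian A * M) ≤ frobNorm M := by
  refine Real.sqrt_le_sqrt ?_
  rw [Finset.sum_comm, Finset.sum_comm (f := fun i j => M i j ^ 2)]
  refine Finset.sum_le_sum fun c _ => ?_
  -- Cauchy–Schwarz with `Ã = √Ã · √Ã`: the weights `Ã i j / D̃ i` in row `i` sum to one, and after
  -- summing over `i` the symmetry of `Ã` cancels `D̃ j`. The degrees disappear altogether.
  have hentry : ∀ i, (normLaplacian A * M) i c =
      ∑ j, (Real.sqrt (augAdj A i j) / Real.sqrt (augDeg A i)) *
        (Real.sqrt (augAdj A i j) * (M j c / Real.sqrt (augDeg A j))) := by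
    intro i
    rw [Matrix.mul_apply]
    refine Finset.sum_congr rfl fun j _ => ?_
    rw [normLaplacian, Matrix.mul_diagonal, Matrix.diagonal_mul]
    have := Real.mul_self_sqrt (augAdj_nonneg A i j)
    calc _ = (Real.sqrt (augAdj A i j) * Real.sqrt (augAdj A i j)) *
          ((Real.sqrt (augDeg A i))⁻¹ * (Real.sqrt (augDeg A j))⁻¹ * M j c) := by
          rw [this]; ring
      _ = _ := by simp only [div_eq_mul_inv]; ring
  have hrow : ∀ i, (normLaplacian A * M) i c ^ 2 ≤
      ∑ j, augAdj A i j * (M j c ^ 2 / augDeg A j) := by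
    intro i
    rw [hentry]
    refine (Finset.sum_mul_sq_le_sq_mul_sq _ _ _).trans (le_of_eq ?_)
    have h1 : ∑ j, (Real.sqrt (augAdj A i j) / Real.sqrt (augDeg A i)) ^ 2 = 1 := by
      simp_rw [div_pow, Real.sq_sqrt (augAdj_nonneg A i _), Real.sq_sqrt (augDeg_pos A i).le]
      rw [← Finset.sum_div]
      exact div_self (augDeg_pos A i).ne'
    rw [h1, one_mul]
    refine Finset.sum_congr rfl fun j _ => ?_
    rw [mul_pow, div_pow, Real.sq_sqrt (augAdj_nonneg A i j), Real.sq_sqrt (augDeg_pos A j).le]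
  calc _ ≤ ∑ i, ∑ j, augAdj A i j * (M j c ^ 2 / augDeg A j) :=
        Finset.sum_le_sum fun i _ => hrow i
    _ = ∑ j, M j c ^ 2 := by
        rw [Finset.sum_comm]
        refine Finset.sum_congr rfl fun j _ => ?_
        rw [← Finset.sum_mul]
        simp_rw [augAdj_symm A _ j]
        exact mul_div_cancel₀ _ (augDeg_pos A j).ne'

/-- Cauchy–Schwarz on the column mean. The `1 / √n` is what later cancels the `√n` of
`frobNorm_le_sqrt_mul_specNorm`. -/
lemma abs_mean_vecMul_le (M : Matrix (Fin n) (Fin p) ℝ) (hn : 1 ≤ n) (j : Fin p) :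
    |((fun _ : Fin n => (1 / n : ℝ)) ᵥ* M) j| ≤ frobNorm M / Real.sqrt n := by
  have hn0 : (0 : ℝ) < n := by exact_mod_cast hn
  refine abs_le_of_sq_le_sq ?_ (div_nonneg (frobNorm_nonneg _) (Real.sqrt_nonneg _))
  rw [div_pow, Real.sq_sqrt hn0.le, frobNorm_sq]
  simp only [Matrix.vecMul, dotProduct]
  rw [← Finset.mul_sum, mul_pow]
  have h1 : (∑ i, M i j) ^ 2 ≤ n * ∑ i, M i j ^ 2 := by
    simpa using sq_sum_le_card_mul_sum_sq (s := Finset.univ) (f := fun i => M i j)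
  have h2 : ∑ i, M i j ^ 2 ≤ ∑ i, ∑ j, M i j ^ 2 :=
    Finset.sum_le_sum fun i _ =>
      Finset.single_le_sum (f := fun j => M i j ^ 2) (fun _ _ => sq_nonneg _) (Finset.mem_univ j)
  calc (1 / n : ℝ) ^ 2 * (∑ i, M i j) ^ 2 ≤ (1 / n : ℝ) ^ 2 * (n * ∑ i, ∑ j, M i j ^ 2) := by
        gcongr
        exact h1.trans (by gcongr)
    _ = _ := by field_simp

end Norms

/-! ### Size, perturbation and homogeneity of the network. -/

section Network

variable {l L n : ℕ} {d : ℕ → ℕ}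

lemma frobNorm_layer_le (A : SimpleGraph (Fin n)) {p q : ℕ} (H : Matrix (Fin n) (Fin p) ℝ)
    (W : Matrix (Fin p) (Fin q) ℝ) :
    frobNorm (normLaplacian A * H * W) ≤ frobNorm H * specNorm W :=
  (frobNorm_mul_le _ _).trans
    (mul_le_mul_of_nonneg_right (frobNorm_normLaplacian_mul_le A H) (specNorm_nonneg W))

lemma frobNorm_nodeRep_le (W : Weights l d) (G : AttrGraph n (d 0)) {c : ℝ}
    (hc : 0 ≤ c) (hW : ∀ k, specNorm (W k) ≤ c) :
    ∀ (k : ℕ) (hk : k ≤ l), frobNorm (nodeRep W G k hk) ≤ c ^ k * frobNorm G.1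
  | 0, _ => by simp [nodeRep]
  | k + 1, hk => by
    rw [nodeRep]
    calc _ ≤ frobNorm (nodeRep W G k (Nat.le_of_succ_le hk)) * specNorm (W ⟨k, hk⟩) :=
          (frobNorm_relu_le _).trans (frobNorm_layer_le _ _ _)
      _ ≤ (c ^ k * frobNorm G.1) * c :=
          mul_le_mul (frobNorm_nodeRep_le W G hc hW k _) (hW _) (specNorm_nonneg _)
            (mul_nonneg (pow_nonneg hc k) (frobNorm_nonneg _))
      _ = _ := by ring

lemma abs_gcn_le (W : Weights (L + 1) d) (G : AttrGraph n (d 0)) (hn : 1 ≤ n) {c : ℝ}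
    (hc : 0 ≤ c) (hW : ∀ k, specNorm (W k) ≤ c) (j : Fin (d (L + 1))) :
    |gcn W G j| ≤ c ^ (L + 1) * specNorm G.1 := by
  have hn0 : 0 < Real.sqrt n := Real.sqrt_pos.2 (by exact_mod_cast hn)
  refine (abs_mean_vecMul_le _ hn j).trans ?_
  rw [div_le_iff₀ hn0]
  calc _ ≤ frobNorm (nodeRep W G L (Nat.le_succ L)) * specNorm (W ⟨L, Nat.lt_succ_self L⟩) :=
        frobNorm_mul_le _ _
    _ ≤ (c ^ L * frobNorm G.1) * c :=
        mul_le_mul (frobNorm_nodeRep_le W G hc hW L _) (hW _) (specNorm_nonneg _)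
          (mul_nonneg (pow_nonneg hc L) (frobNorm_nonneg _))
    _ ≤ (c ^ L * (Real.sqrt n * specNorm G.1)) * c := by
        gcongr
        exact frobNorm_le_sqrt_mul_specNorm _
    _ = _ := by ring

/-- Inductive step of the perturbation bound, used with `a = (1 + u) ^ k` and `b = (1 + u) ^ (k +
1)`; it rests on `(a - 1) (1 + u) + u = b - 1`. -/
lemma frobNorm_mul_sub_mul_le {p q : ℕ} (H H' : Matrix (Fin n) (Fin p) ℝ)
    (W W' : Matrix (Fin p) (Fin q) ℝ) {a b F u : ℝ} (hW : specNorm W ≤ 1)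
    (hu : specNorm (W' - W) ≤ u) (hH : frobNorm H ≤ F) (hH' : frobNorm (H' - H) ≤ (a - 1) * F)
    (hab : a * (1 + u) = b) :
    frobNorm (H' * W' - H * W) ≤ (b - 1) * F := by
  have e : H' * W' - H * W = (H' - H) * W' + H * (W' - W) := by
    rw [Matrix.sub_mul, Matrix.mul_sub]
    abel
  have hW' : specNorm W' ≤ 1 + u := by
    have := specNorm_add_le W (W' - W)
    rw [add_sub_cancel] at this
    linarith
  have hF : 0 ≤ (a - 1) * F := (frobNorm_nonneg _).trans hH'
  have hF0 : 0 ≤ F := (frobNorm_nonneg _).trans hH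
  have hu0 : 0 ≤ u := (specNorm_nonneg _).trans hu
  rw [e]
  calc _ ≤ frobNorm (H' - H) * specNorm W' + frobNorm H * specNorm (W' - W) :=
        (frobNorm_add_le _ _).trans (add_le_add (frobNorm_mul_le _ _) (frobNorm_mul_le _ _))
    _ ≤ ((a - 1) * F) * (1 + u) + F * u :=
        add_le_add (mul_le_mul hH' hW' (specNorm_nonneg _) hF)
          (mul_le_mul hH hu (specNorm_nonneg _) hF0)
    _ = (b - 1) * F := by rw [← hab]; ring

lemma frobNorm_nodeRep_sub_le (V W : Weights l d) (G : AttrGraph n (d 0)) {u : ℝ}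
    (hW : ∀ k, specNorm (W k) ≤ 1) (hu : ∀ k, specNorm (V k - W k) ≤ u) :
    ∀ (k : ℕ) (hk : k ≤ l),
      frobNorm (nodeRep V G k hk - nodeRep W G k hk) ≤ ((1 + u) ^ k - 1) * frobNorm G.1
  | 0, _ => by simp [nodeRep, frobNorm]
  | k + 1, hk => by
    rw [nodeRep, nodeRep]
    refine (frobNorm_relu_sub_le _ _).trans ?_
    rw [Matrix.mul_assoc, Matrix.mul_assoc, ← Matrix.mul_sub]
    refine (frobNorm_normLaplacian_mul_le _ _).trans ?_
    refine frobNorm_mul_sub_mul_le _ _ _ _ (hW _) (hu _) ?_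
      (frobNorm_nodeRep_sub_le V W G hW hu k _) (pow_succ _ _).symm
    simpa using frobNorm_nodeRep_le W G zero_le_one hW k (Nat.le_of_succ_le hk)

/-- Perturbation bound for normalized weights. -/
lemma abs_gcn_sub_le (V W : Weights (L + 1) d) (G : AttrGraph n (d 0)) (hn : 1 ≤ n) {u : ℝ}
    (hW : ∀ k, specNorm (W k) ≤ 1) (hu : ∀ k, specNorm (V k - W k) ≤ u)
    (j : Fin (d (L + 1))) :
    |gcn V G j - gcn W G j| ≤ ((1 + u) ^ (L + 1) - 1) * specNorm G.1 := by
  have hn0 : 0 < Real.sqrt n := Real.sqrt_pos.2 (by exact_mod_cast hn)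
  have hu0 : 0 ≤ u := (specNorm_nonneg _).trans (hu 0)
  have h1 : gcn V G j - gcn W G j = ((fun _ : Fin n => (1 / n : ℝ)) ᵥ*
      (nodeRep V G L (Nat.le_succ L) * V ⟨L, Nat.lt_succ_self L⟩ -
        nodeRep W G L (Nat.le_succ L) * W ⟨L, Nat.lt_succ_self L⟩)) j := by
    rw [Matrix.vecMul_sub]
    rfl
  rw [h1]
  refine (abs_mean_vecMul_le _ hn j).trans ?_
  rw [div_le_iff₀ hn0]
  have h2 : frobNorm (nodeRep W G L (Nat.le_succ L)) ≤ frobNorm G.1 := by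
    simpa using frobNorm_nodeRep_le W G zero_le_one hW L (Nat.le_succ L)
  have h3 := frobNorm_mul_sub_mul_le _ _ _ _ (hW ⟨L, Nat.lt_succ_self L⟩)
    (hu ⟨L, Nat.lt_succ_self L⟩) h2 (frobNorm_nodeRep_sub_le V W G hW hu L _) (pow_succ _ _).symm
  refine h3.trans ?_
  have h4 : (0 : ℝ) ≤ (1 + u) ^ (L + 1) - 1 := sub_nonneg.2 (one_le_pow₀ (by linarith))
  calc _ ≤ ((1 + u) ^ (L + 1) - 1) * (Real.sqrt n * specNorm G.1) :=
        mul_le_mul_of_nonneg_left (frobNorm_le_sqrt_mul_specNorm _) h4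
    _ = _ := by ring

lemma one_add_pow_sub_one_le {u : ℝ} (hu : 0 ≤ u) (k : ℕ) (hk : k * u ≤ 1) :
    (1 + u) ^ k - 1 ≤ 2 * (k * u) := by
  have h1 : (1 + u) ^ k ≤ Real.exp (k * u) := by
    rw [Real.exp_nat_mul]
    exact pow_le_pow_left₀ (by linarith) (by linarith [Real.add_one_le_exp u]) k
  have hku : 0 ≤ k * u := by positivity
  have h2 := Real.abs_exp_sub_one_le (x := k * u) (by rwa [abs_of_nonneg hku])
  rw [abs_of_nonneg hku] at h2
  linarith [le_abs_self (Real.exp (k * u) - 1)]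

lemma nodeRep_smul (c : Fin l → ℝ) (hc : ∀ k, 0 ≤ c k) (W : Weights l d)
    (G : AttrGraph n (d 0)) : ∀ (k : ℕ) (hk : k ≤ l),
      nodeRep (fun k => c k • W k) G k hk =
        (∏ i : Fin k, c (Fin.castLE hk i)) • nodeRep W G k hk
  | 0, _ => by simp [nodeRep]
  | k + 1, hk => by
    rw [nodeRep, nodeRep, nodeRep_smul c hc W G k, ← relu_smul (Finset.prod_nonneg fun _ _ => hc _),
      Fin.prod_univ_castSucc, Matrix.mul_smul, Matrix.mul_smul, Matrix.smul_mul, smul_smul,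
      mul_comm]
    rfl

/-- Positive homogeneity of the network in each weight matrix. -/
lemma gcn_smul (c : Fin (L + 1) → ℝ) (hc : ∀ k, 0 ≤ c k) (W : Weights (L + 1) d)
    (G : AttrGraph n (d 0)) :
    gcn (fun k => c k • W k) G = (∏ i, c i) • gcn W G := by
  rw [gcn, gcn, nodeRep_smul c hc, Fin.prod_univ_castSucc, Matrix.mul_smul, Matrix.smul_mul,
    smul_smul, Matrix.vecMul_smul, mul_comm]
  rfl

end Network

/-! ### Lipschitz continuity and homogeneity of the margin. -/

section Margin

variable {K : ℕ}

/-- Ensures that the supremum in `margin` is a genuine maximum and not the default value `0` of an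
empty one. -/
lemma nonempty_ne_of_two_le (hK : 2 ≤ K) (y : Fin K) : Nonempty {j : Fin K // j ≠ y} := by
  have : Nontrivial (Fin K) := Fin.nontrivial_iff_two_le.2 hK
  obtain ⟨j, hj⟩ := exists_ne y
  exact ⟨⟨j, hj⟩⟩

lemma margin_le_add (hK : 2 ≤ K) {v w : Fin K → ℝ} {η : ℝ} (h : ∀ j, |v j - w j| ≤ η)
    (y : Fin K) : margin v y ≤ margin w y + 2 * η := by
  have := nonempty_ne_of_two_le hK y
  have h1 : ⨆ j : {j : Fin K // j ≠ y}, w j ≤ (⨆ j : {j : Fin K // j ≠ y}, v j) + η := by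
    refine ciSup_le fun j => ?_
    have h2 := le_ciSup (f := fun j : {j : Fin K // j ≠ y} => v j) (Set.finite_range _).bddAbove j
    have h3 := (abs_le.1 (h j)).1
    linarith
  have h4 := (abs_le.1 (h y)).2
  unfold margin
  linarith

lemma abs_margin_sub_le (hK : 2 ≤ K) {v w : Fin K → ℝ} {η : ℝ} (h : ∀ j, |v j - w j| ≤ η)
    (y : Fin K) : |margin v y - margin w y| ≤ 2 * η := by
  rw [abs_sub_le_iff]
  have h1 := margin_le_add hK h y
  have h2 := margin_le_add hK (v := w) (w := v) (fun j => by rw [abs_sub_comm]; exact h j) y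
  constructor <;> linarith

lemma margin_zero (y : Fin K) : margin (0 : Fin K → ℝ) y = 0 := by
  simp [margin]

lemma abs_margin_le (hK : 2 ≤ K) {v : Fin K → ℝ} {η : ℝ} (h : ∀ j, |v j| ≤ η) (y : Fin K) :
    |margin v y| ≤ 2 * η := by
  simpa [margin_zero] using abs_margin_sub_le hK (v := v) (w := 0) (by simpa using h) y

lemma continuous_margin (hK : 2 ≤ K) (y : Fin K) : Continuous fun v : Fin K → ℝ => margin v y := by
  refine (LipschitzWith.of_dist_le_mul (K := 2) fun v w => ?_).continuous
  rw [Real.dist_eq]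
  exact abs_margin_sub_le hK (fun j => by rw [← Real.dist_eq]; exact dist_le_pi_dist v w j) y

lemma margin_smul {s : ℝ} (hs : 0 ≤ s) (v : Fin K → ℝ) (y : Fin K) :
    margin (s • v) y = s * margin v y := by
  rw [margin, margin, mul_sub, Real.mul_iSup_of_nonneg hs]
  rfl

end Margin

/-! ### Stability and homogeneity of the robust margin. -/

section RobustMargin

variable {L n : ℕ} {d : ℕ → ℕ} {ε : ℝ}

lemma self_mem_attackSet (hε : 0 ≤ ε) {p : ℕ} (G : AttrGraph n p) : G ∈ attackSet ε G := by
  simpa [attackSet, specNorm_zero] using hε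

lemma specNorm_le_of_mem_attackSet {p : ℕ} {G G' : AttrGraph n p} (h : G' ∈ attackSet ε G) :
    specNorm G'.1 ≤ specNorm G.1 + ε := by
  have h1 := specNorm_add_le G.1 (G'.1 - G.1)
  rw [add_sub_cancel] at h1
  have h2 : specNorm (G'.1 - G.1) ≤ ε := h
  linarith

lemma abs_margin_gcn_le (hn : 1 ≤ n) (hK : 2 ≤ d (L + 1)) (W : Weights (L + 1) d) {c : ℝ}
    (hc : 0 ≤ c) (hW : ∀ k, specNorm (W k) ≤ c) (z : Sample n (d 0) (d (L + 1)))
    (G' : attackSet ε z.1) :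
    |margin (gcn W G'.1) z.2| ≤ 2 * (c ^ (L + 1) * (specNorm z.1.1 + ε)) :=
  abs_margin_le hK (fun j => (abs_gcn_le W G'.1 hn hc hW j).trans
    (mul_le_mul_of_nonneg_left (specNorm_le_of_mem_attackSet G'.2) (pow_nonneg hc _))) z.2

/-- Needed because the real infimum of a set unbounded below is `0` by convention. The sum of the
spectral norms serves as a crude common bound for all layers. -/
lemma bddBelow_margin_gcn (hn : 1 ≤ n) (hK : 2 ≤ d (L + 1)) (W : Weights (L + 1) d)
    (z : Sample n (d 0) (d (L + 1))) :
    BddBelow (Set.range fun G' : attackSet ε z.1 => margin (gcn W G'.1) z.2) := by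
  refine ⟨-(2 * ((∑ k, specNorm (W k)) ^ (L + 1) * (specNorm z.1.1 + ε))), ?_⟩
  rintro _ ⟨G', rfl⟩
  refine neg_le_of_abs_le (abs_margin_gcn_le hn hK W
    (Finset.sum_nonneg fun k _ => specNorm_nonneg _) (fun k => ?_) z G')
  exact Finset.single_le_sum (f := fun k => specNorm (W k)) (fun k _ => specNorm_nonneg _)
    (Finset.mem_univ k)

lemma robustMargin_le_add (hε : 0 ≤ ε) (hn : 1 ≤ n) (hK : 2 ≤ d (L + 1)) {V W : Weights (L + 1) d}
    {z : Sample n (d 0) (d (L + 1))} {η : ℝ}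
    (h : ∀ G' ∈ attackSet ε z.1, |margin (gcn V G') z.2 - margin (gcn W G') z.2| ≤ η) :
    robustMargin ε V z ≤ robustMargin ε W z + η := by
  have : Nonempty (attackSet ε z.1) := ⟨⟨z.1, self_mem_attackSet hε z.1⟩⟩
  rw [← sub_le_iff_le_add]
  refine le_ciInf fun G' => ?_
  have h1 := ciInf_le (bddBelow_margin_gcn hn hK V z) G'
  have h2 := (abs_le.1 (h G'.1 G'.2)).2
  unfold robustMargin
  linarith

/-- Stability of the robust margin at normalized weights. -/
lemma abs_robustMargin_sub_le (hε : 0 ≤ ε) (hn : 1 ≤ n) (hK : 2 ≤ d (L + 1))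
    {V W : Weights (L + 1) d} {z : Sample n (d 0) (d (L + 1))} {B u : ℝ} (hB : specNorm z.1.1 ≤ B)
    (hW : ∀ k, specNorm (W k) ≤ 1) (hu : ∀ k, specNorm (V k - W k) ≤ u)
    (hu1 : ((L + 1 : ℕ) : ℝ) * u ≤ 1) :
    |robustMargin ε V z - robustMargin ε W z| ≤ 4 * (((L + 1 : ℕ) : ℝ) * u) * (B + ε) := by
  have hu0 : 0 ≤ u := (specNorm_nonneg _).trans (hu 0)
  have key : ∀ G' ∈ attackSet ε z.1, |margin (gcn V G') z.2 - margin (gcn W G') z.2| ≤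
      4 * (((L + 1 : ℕ) : ℝ) * u) * (B + ε) := by
    intro G' hG'
    have h1 : ∀ j, |gcn V G' j - gcn W G' j| ≤ 2 * (((L + 1 : ℕ) : ℝ) * u) * (B + ε) := by
      intro j
      refine (abs_gcn_sub_le V W G' hn hW hu j).trans ?_
      exact mul_le_mul (one_add_pow_sub_one_le hu0 (L + 1) hu1)
        ((specNorm_le_of_mem_attackSet hG').trans (by linarith)) (specNorm_nonneg _)
        (by positivity)
    refine (abs_margin_sub_le hK h1 z.2).trans (le_of_eq ?_)
    ring
  rw [abs_sub_le_iff]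
  constructor
  · have := robustMargin_le_add hε hn hK key
    linarith
  · have := robustMargin_le_add hε hn hK (V := W) (W := V)
      (fun G' hG' => by rw [abs_sub_comm]; exact key G' hG')
    linarith

lemma robustMargin_le (hε : 0 ≤ ε) (hn : 1 ≤ n) (hK : 2 ≤ d (L + 1)) {W : Weights (L + 1) d}
    {z : Sample n (d 0) (d (L + 1))} {B : ℝ} (hB : specNorm z.1.1 ≤ B)
    (hW : ∀ k, specNorm (W k) ≤ 1) : robustMargin ε W z ≤ 2 * (B + ε) := by
  have h1 := ciInf_le (bddBelow_margin_gcn (ε := ε) hn hK W z) ⟨z.1, self_mem_attackSet hε z.1⟩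
  have h2 := le_of_abs_le (abs_margin_gcn_le hn hK W zero_le_one hW z
    ⟨z.1, self_mem_attackSet hε z.1⟩)
  rw [one_pow, one_mul] at h2
  unfold robustMargin
  linarith

lemma robustMargin_smul (c : Fin (L + 1) → ℝ) (hc : ∀ k, 0 ≤ c k) (W : Weights (L + 1) d)
    (z : Sample n (d 0) (d (L + 1))) :
    robustMargin ε (fun k => c k • W k) z = (∏ i, c i) * robustMargin ε W z := by
  have hp : 0 ≤ ∏ i, c i := Finset.prod_nonneg fun i _ => hc i
  simp only [robustMargin]
  rw [Real.mul_iInf_of_nonneg hp]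
  congr 1
  ext G'
  rw [gcn_smul c hc, margin_smul hp]

/-- The weights rescaled to spectral norm one. -/
def normalize (W : Weights (L + 1) d) : Weights (L + 1) d := fun k => (specNorm (W k))⁻¹ • W k

lemma specNorm_normalize_le (W : Weights (L + 1) d) (k : Fin (L + 1)) :
    specNorm (normalize W k) ≤ 1 := by
  rw [normalize, specNorm_smul, abs_of_nonneg (inv_nonneg.2 (specNorm_nonneg _))]
  exact inv_mul_le_one

lemma robustMargin_eq_prod_mul (W : Weights (L + 1) d) (z : Sample n (d 0) (d (L + 1))) :
    robustMargin ε W z = (∏ k, specNorm (W k)) * robustMargin ε (normalize W) z := by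
  rw [← robustMargin_smul (fun k => specNorm (W k)) (fun k => specNorm_nonneg _)]
  congr 1
  ext1 k
  -- A zero layer is normalized to zero since `0⁻¹ = 0`, so the identity holds there too.
  by_cases h : specNorm (W k) = 0
  · rw [h, zero_smul, eq_zero_of_specNorm_eq_zero h]
  · rw [normalize, smul_smul, mul_inv_cancel₀ h, one_smul]

end RobustMargin

/-! ### The Gaussian prior on weights. -/

section Prior

variable {l : ℕ} {d : ℕ → ℕ}

/-- The coordinates of a family of weight matrices. -/
abbrev WeightIdx (l : ℕ) (d : ℕ → ℕ) : Type := (k : Fin l) × (Fin (d k) × Fin (d (k + 1)))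

/-- The coordinates of the `k`-th weight matrix. -/
def layerIdx (k : Fin l) (ij : Fin (d k) × Fin (d (k + 1))) : WeightIdx l d := ⟨k, ij⟩

lemma layerIdx_injective (k : Fin l) : Function.Injective (layerIdx (d := d) k) :=
  sigma_mk_injective (β := fun k : Fin l => Fin (d k) × Fin (d (k + 1))) (i := k)

/-- Weight matrices from their coordinates. -/
def toWeights (ω : WeightIdx l d → ℝ) : Weights l d := fun k => coordMatrix (layerIdx k) ω

lemma continuous_toWeights (k : Fin l) :
    Continuous fun ω : WeightIdx l d → ℝ => toWeights ω k :=
  continuous_coordMatrix _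

lemma sum_sq_weightIdx (W : Weights l d) :
    ∑ a : WeightIdx l d, W a.1 a.2.1 a.2.2 ^ 2 = ∑ k, frobNorm (W k) ^ 2 := by
  rw [Fintype.sum_sigma]
  refine Finset.sum_congr rfl fun k _ => ?_
  rw [frobNorm_sq, Fintype.sum_prod_type]

lemma measurableSet_specNorm_toWeights_le (t : ℝ) :
    MeasurableSet {ω : WeightIdx l d → ℝ | ∀ k, specNorm (toWeights ω k) ≤ t} := by
  rw [Set.ofPred_forall]
  refine MeasurableSet.iInter fun k => IsClosed.measurableSet ?_
  exact isClosed_le (continuous_specNorm.comp (continuous_toWeights k)) continuous_const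

/-- With probability at least `1/2` all Gaussian weight matrices have spectral norm at most `t`. -/
lemma half_le_stdGauss_specNorm_le {h : ℕ} (hd : ∀ k ≤ l, d k ≤ h) {t : ℝ} (ht : 0 < t)
    (hlt : (l : ℝ) * (64 ^ h * Real.exp (-(t ^ 2 / 32))) ≤ 1 / 2) :
    ENNReal.ofReal (1 / 2) ≤
      stdGauss (WeightIdx l d) {ω | ∀ k, specNorm (toWeights ω k) ≤ t} := by
  set G : Set (WeightIdx l d → ℝ) := {ω | ∀ k, specNorm (toWeights ω k) ≤ t} with hG
  have hGm : MeasurableSet G := measurableSet_specNorm_toWeights_le t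
  have h1 : stdGauss (WeightIdx l d) Gᶜ ≤ ENNReal.ofReal (1 / 2) := by
    have hsub : Gᶜ ⊆ ⋃ k : Fin l, {ω | t < specNorm (coordMatrix (layerIdx k) ω)} := by
      intro ω hω
      simp only [hG, Set.mem_compl_iff, Set.mem_ofPred_eq, not_forall, not_le] at hω
      exact Set.mem_iUnion.2 hω
    calc _ ≤ ∑ k : Fin l, stdGauss (WeightIdx l d)
            {ω | t < specNorm (coordMatrix (layerIdx k) ω)} :=
          (measure_mono hsub).trans (measure_iUnion_fintype_le _ _)
      _ ≤ ∑ _k : Fin l, ENNReal.ofReal (64 ^ h * Real.exp (-(t ^ 2 / 32))) := by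
          refine Finset.sum_le_sum fun k _ => ?_
          refine (stdGauss_specNorm_gt_le _ (layerIdx_injective k) ht).trans
            (ENNReal.ofReal_le_ofReal ?_)
          refine mul_le_mul_of_nonneg_right ?_ (Real.exp_pos _).le
          have hk : d k + d (k + 1) ≤ 2 * h := by
            have := hd k k.2.le
            have := hd (k + 1) k.2
            omega
          calc (8 : ℝ) ^ (d k + d (k + 1)) ≤ 8 ^ (2 * h) :=
                pow_le_pow_right₀ (by norm_num) hk
            _ = 64 ^ h := by rw [pow_mul]; norm_num
      _ = ENNReal.ofReal (l * (64 ^ h * Real.exp (-(t ^ 2 / 32)))) := by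
          rw [Finset.sum_const, Finset.card_univ, Fintype.card_fin, nsmul_eq_mul,
            ENNReal.ofReal_mul (Nat.cast_nonneg _), ENNReal.ofReal_natCast]
      _ ≤ _ := ENNReal.ofReal_le_ofReal hlt
  have h2 := prob_compl_eq_one_sub (μ := stdGauss (WeightIdx l d)) hGm.compl
  rw [compl_compl] at h2
  rw [h2]
  have h3 : ENNReal.ofReal (1 / 2) = 1 - ENNReal.ofReal (1 / 2) := by
    rw [← ENNReal.ofReal_one, ← ENNReal.ofReal_sub _ (by norm_num)]
    norm_num
  rw [h3]
  exact tsub_le_tsub_left h1 _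

/-- Lower bound on the mass which the Gaussian prior of scale `σ` gives to a spectral
neighbourhood of `W`. -/
lemma le_stdGauss_neighbourhood {h : ℕ} (hd : ∀ k ≤ l, d k ≤ h) {t : ℝ} (ht : 0 < t)
    (hlt : (l : ℝ) * (64 ^ h * Real.exp (-(t ^ 2 / 32))) ≤ 1 / 2) {σ : ℝ} (hσ : 0 < σ)
    (W : Weights l d) :
    Real.exp (-(∑ k, frobNorm (W k) ^ 2) / (2 * σ ^ 2)) * (1 / 2) ≤
      (stdGauss (WeightIdx l d)).real
        {ω | ∀ k, specNorm (toWeights (σ • ω) k - W k) ≤ σ * t} := by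
  have h1 := half_le_stdGauss_specNorm_le hd ht hlt
  have h2 := le_stdGauss_translate (fun a : WeightIdx l d => σ⁻¹ * W a.1 a.2.1 a.2.2)
    (measurableSet_specNorm_toWeights_le t) (fun ω hω k => by
      have : toWeights (-ω) k = (-1 : ℝ) • toWeights ω k := by
        rw [neg_one_smul]; rfl
      rw [this, specNorm_smul, abs_neg, abs_one, one_mul]
      exact hω k)
  have h3 : (∑ a : WeightIdx l d, (σ⁻¹ * W a.1 a.2.1 a.2.2) ^ 2) =
      (σ⁻¹) ^ 2 * ∑ k, frobNorm (W k) ^ 2 := by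
    rw [← sum_sq_weightIdx, Finset.mul_sum]
    exact Finset.sum_congr rfl fun a _ => by rw [mul_pow]
  rw [h3] at h2
  have h4 := (mul_le_mul_right h1 _).trans h2
  rw [← ENNReal.ofReal_mul (Real.exp_pos _).le] at h4
  rw [← ENNReal.ofReal_le_ofReal_iff measureReal_nonneg, ofReal_measureReal]
  calc _ = ENNReal.ofReal (Real.exp (-(σ⁻¹ ^ 2 * ∑ k, frobNorm (W k) ^ 2) / 2) * (1 / 2)) := by
        congr 3
        field_simp
    _ ≤ _ := h4
    _ ≤ _ := by
      refine measure_mono fun ω hω k => ?_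
      have hk : toWeights (σ • ω) k - W k = σ • toWeights
          (ω - fun a : WeightIdx l d => σ⁻¹ * W a.1 a.2.1 a.2.2) k := by
        ext i j
        simp only [toWeights, coordMatrix, Matrix.sub_apply, Matrix.smul_apply, Pi.smul_apply,
          Pi.sub_apply, smul_eq_mul]
        field_simp
        rfl
      rw [hk, specNorm_smul, abs_of_pos hσ]
      exact mul_le_mul_of_nonneg_left (hω k) hσ.le

end Prior

/-! ### Measurability of the robust margin. -/

section Measurability

instance {n p : ℕ} : BorelSpace (Matrix (Fin n) (Fin p) ℝ) :=
  inferInstanceAs (BorelSpace (Fin n → Fin p → ℝ))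

instance {n p : ℕ} : SecondCountableTopology (Matrix (Fin n) (Fin p) ℝ) :=
  inferInstanceAs (SecondCountableTopology (Fin n → Fin p → ℝ))

variable {l L n : ℕ} {d : ℕ → ℕ}

lemma continuous_nodeRep {T : Type*} [TopologicalSpace T] {W : T → Weights l d}
    (hW : ∀ k, Continuous fun s => W s k) {X : T → Matrix (Fin n) (Fin (d 0)) ℝ}
    (hX : Continuous X) (A : SimpleGraph (Fin n)) :
    ∀ (k : ℕ) (hk : k ≤ l), Continuous fun s => nodeRep (W s) (X s, A) k hk
  | 0, _ => hX
  | k + 1, hk => by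
    simp only [nodeRep, relu]
    refine Continuous.matrix_map ?_ (continuous_const.max continuous_id)
    exact (continuous_const.matrix_mul (continuous_nodeRep hW hX A k _)).matrix_mul (hW _)

lemma continuous_gcn {T : Type*} [TopologicalSpace T] {W : T → Weights (L + 1) d}
    (hW : ∀ k, Continuous fun s => W s k) {X : T → Matrix (Fin n) (Fin (d 0)) ℝ}
    (hX : Continuous X) (A : SimpleGraph (Fin n)) :
    Continuous fun s => gcn (W s) (X s, A) :=
  continuous_const.matrix_vecMul ((continuous_nodeRep hW hX A L _).matrix_mul (hW _))

/-- Indexing attacks by `Δ = X' - X` makes the index set independent of `X`. Strict sublevel sets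
then become unions of open sets, so an uncountable infimum causes no measurability problem. -/
lemma robustMargin_lt_iff {ε : ℝ} (hε : 0 ≤ ε) (hn : 1 ≤ n) (hK : 2 ≤ d (L + 1))
    (W : Weights (L + 1) d) (X : Matrix (Fin n) (Fin (d 0)) ℝ) (A : SimpleGraph (Fin n))
    (y : Fin (d (L + 1))) (c : ℝ) :
    robustMargin ε W ((X, A), y) < c ↔
      ∃ (Δ : Matrix (Fin n) (Fin (d 0)) ℝ) (A' : SimpleGraph (Fin n)),
        specNorm Δ ≤ ε ∧ margin (gcn W (X + Δ, A')) y < c := by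
  have : Nonempty (attackSet ε (X, A)) := ⟨⟨(X, A), self_mem_attackSet hε _⟩⟩
  constructor
  · intro h
    obtain ⟨⟨⟨X', A'⟩, hG⟩, hlt⟩ := exists_lt_of_ciInf_lt h
    exact ⟨X' - X, A', hG, by rw [add_sub_cancel]; exact hlt⟩
  · rintro ⟨Δ, A', hΔ, hlt⟩
    refine (ciInf_le (bddBelow_margin_gcn hn hK W ((X, A), y)) ⟨(X + Δ, A'), ?_⟩).trans_lt hlt
    simpa [attackSet] using hΔ

/-- The robust margin does not depend on the edges of the attacked graph. -/
lemma robustMargin_eq_bot (ε : ℝ) (W : Weights (L + 1) d) (z : Sample n (d 0) (d (L + 1))) :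
    robustMargin ε W z = robustMargin ε W ((z.1.1, ⊥), z.2) :=
  rfl

lemma measurable_robustMargin_bot {ε : ℝ} (hε : 0 ≤ ε) (hn : 1 ≤ n) (hK : 2 ≤ d (L + 1)) (σ : ℝ)
    (y : Fin (d (L + 1))) :
    Measurable fun q : (WeightIdx (L + 1) d → ℝ) × Matrix (Fin n) (Fin (d 0)) ℝ =>
      robustMargin ε (toWeights (σ • q.1)) ((q.2, ⊥), y) := by
  refine measurable_of_Iio fun c => IsOpen.measurableSet ?_
  have hset : (fun q : (WeightIdx (L + 1) d → ℝ) × Matrix (Fin n) (Fin (d 0)) ℝ =>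
      robustMargin ε (toWeights (σ • q.1)) ((q.2, ⊥), y)) ⁻¹' Set.Iio c =
      ⋃ (Δ : Matrix (Fin n) (Fin (d 0)) ℝ) (A' : SimpleGraph (Fin n)) (_ : specNorm Δ ≤ ε),
        {q | margin (gcn (toWeights (σ • q.1)) (q.2 + Δ, A')) y < c} := by
    ext q
    simp only [Set.mem_preimage, Set.mem_Iio, robustMargin_lt_iff hε hn hK, Set.mem_iUnion,
      Set.mem_ofPred_eq, exists_prop]
  rw [hset]
  refine isOpen_iUnion fun Δ => isOpen_iUnion fun A' => isOpen_iUnion fun _ => ?_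
  have hW : ∀ k, Continuous fun q : (WeightIdx (L + 1) d → ℝ) ×
      Matrix (Fin n) (Fin (d 0)) ℝ => toWeights (σ • q.1) k := fun k =>
    (continuous_toWeights k).comp (continuous_fst.const_smul σ)
  have hX : Continuous fun q : (WeightIdx (L + 1) d → ℝ) ×
      Matrix (Fin n) (Fin (d 0)) ℝ => q.2 + Δ := continuous_snd.add continuous_const
  exact isOpen_lt ((continuous_margin hK y).comp (continuous_gcn hW hX A')) continuous_const

lemma measurable_robustMargin {ε : ℝ} (hε : 0 ≤ ε) (hn : 1 ≤ n) (hK : 2 ≤ d (L + 1)) (σ : ℝ) :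
    Measurable fun p : (WeightIdx (L + 1) d → ℝ) × Sample n (d 0) (d (L + 1)) =>
      robustMargin ε (toWeights (σ • p.1)) p.2 := by
  let g : ((WeightIdx (L + 1) d → ℝ) × Matrix (Fin n) (Fin (d 0)) ℝ) × Fin (d (L + 1)) → ℝ :=
    fun p => robustMargin ε (toWeights (σ • p.1.1)) ((p.1.2, ⊥), p.2)
  have hg : Measurable g := measurable_from_prod_countable_left fun y =>
    measurable_robustMargin_bot hε hn hK σ y
  let π : (WeightIdx (L + 1) d → ℝ) × Sample n (d 0) (d (L + 1)) →
      ((WeightIdx (L + 1) d → ℝ) × Matrix (Fin n) (Fin (d 0)) ℝ) × Fin (d (L + 1)) :=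
    fun p => ((p.1, p.2.1.1), p.2.2)
  have hπ : Measurable π :=
    (measurable_fst.prodMk (measurable_fst.comp (measurable_fst.comp measurable_snd))).prodMk
      (measurable_snd.comp measurable_snd)
  have hcomp : (fun p : (WeightIdx (L + 1) d → ℝ) × Sample n (d 0) (d (L + 1)) =>
      robustMargin ε (toWeights (σ • p.1)) p.2) = g ∘ π :=
    funext fun p => robustMargin_eq_bot ε _ p.2
  rw [hcomp]
  exact hg.comp hπ

lemma measurableSet_robustMargin_le {ε : ℝ} (hε : 0 ≤ ε) (hn : 1 ≤ n) (hK : 2 ≤ d (L + 1))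
    (σ c : ℝ) :
    MeasurableSet {p : (WeightIdx (L + 1) d → ℝ) × Sample n (d 0) (d (L + 1)) |
      robustMargin ε (toWeights (σ • p.1)) p.2 ≤ c} :=
  measurableSet_le (measurable_robustMargin hε hn hK σ) measurable_const

end Measurability

/-! ### Transfer of the excess risk and numerical estimates. -/

section Assembly

variable {L n m h : ℕ} {d : ℕ → ℕ} {B ε γ δ : ℝ}

lemma one_le_log_of_four_le {x : ℝ} (hx : 4 ≤ x) : 1 ≤ Real.log x := by
  rw [Real.le_log_iff_exp_le (by linarith)]
  linarith [Real.exp_one_lt_three]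

/-- With `t² = 128 H` and `H = h log (l h)` the exponent is `-4 H`: one `H` pays for `log (2 l)` and
three pay for `h log 64`, since `l h ≥ 4`. -/
lemma union_bound_radius (hL : 1 ≤ L) (hh : 2 ≤ h) :
    ((L + 1 : ℕ) : ℝ) * (64 ^ h *
      Real.exp (-(128 * (h * Real.log (((L + 1 : ℕ) : ℝ) * h)) / 32))) ≤ 1 / 2 := by
  have hl2 : (2 : ℝ) ≤ ((L + 1 : ℕ) : ℝ) := by exact_mod_cast Nat.succ_le_succ hL
  have hh2 : (2 : ℝ) ≤ h := by exact_mod_cast hh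
  obtain ⟨l, hl⟩ : ∃ l : ℝ, l = ((L + 1 : ℕ) : ℝ) := ⟨_, rfl⟩
  rw [← hl] at hl2 ⊢
  have hlh : 4 ≤ l * h := by nlinarith
  have h1 : Real.log (2 * l) ≤ h * Real.log (l * h) := by
    have h2 : Real.log (2 * l) ≤ Real.log (l * h) :=
      Real.log_le_log (by positivity) (by nlinarith)
    nlinarith [one_le_log_of_four_le hlh]
  have h3 : Real.log 64 ≤ 3 * Real.log (l * h) := by
    have h4 : Real.log 64 = 3 * Real.log 4 := by
      rw [show (64 : ℝ) = 4 ^ 3 by norm_num, Real.log_pow]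
      norm_num
    have := Real.log_le_log (by norm_num) hlh
    linarith
  have h5 : l * 64 ^ h = Real.exp (Real.log (2 * l) + h * Real.log 64) / 2 := by
    rw [Real.exp_add, Real.exp_log (by positivity), Real.exp_nat_mul, Real.exp_log (by norm_num)]
    ring
  rw [← mul_assoc, h5, div_mul_eq_mul_div, ← Real.exp_add]
  have h6 : Real.exp (Real.log (2 * l) + h * Real.log 64 +
      -(128 * (h * Real.log (l * h)) / 32)) ≤ 1 := by
    rw [Real.exp_le_one_iff]
    have : (h : ℝ) * Real.log 64 ≤ h * (3 * Real.log (l * h)) := by gcongr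
    linarith
  linarith

/-- Normalization turns `Φ` into a sum of squared Frobenius norms. -/
lemma Phi_eq_prod_mul_sum (W : Weights (L + 1) d) :
    Phi W = (∏ k, specNorm (W k)) ^ 2 * ∑ k, frobNorm (normalize W k) ^ 2 := by
  rw [Phi, Finset.prod_pow]
  congr 1
  refine Finset.sum_congr rfl fun k _ => ?_
  rw [normalize, frobNorm_smul_sq, inv_pow, div_eq_inv_mul]

lemma one_le_sum_frobNorm_normalize {W : Weights (L + 1) d} (hW : ∀ k, specNorm (W k) ≠ 0) :
    1 ≤ ∑ k, frobNorm (normalize W k) ^ 2 := by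
  have h1 : ∀ k, 1 ≤ frobNorm (normalize W k) ^ 2 := by
    intro k
    have h2 : specNorm (normalize W k) = 1 := by
      rw [normalize, specNorm_smul, abs_of_nonneg (inv_nonneg.2 (specNorm_nonneg _)),
        inv_mul_cancel₀ (hW k)]
    have h3 := specNorm_le_frobNorm (normalize W k)
    rw [h2] at h3
    exact one_le_pow₀ h3
  exact (h1 0).trans (Finset.single_le_sum (f := fun k => frobNorm (normalize W k) ^ 2)
    (fun _ _ => sq_nonneg _) (Finset.mem_univ 0))

/-- A perturbation of the normalized weights carries the excess risk. -/
lemma excess_le_of_near (hε : 0 ≤ ε) (hn : 1 ≤ n) (hK : 2 ≤ d (L + 1))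
    (D : Measure (Sample n (d 0) (d (L + 1)))) [IsProbabilityMeasure D]
    (hD : ∀ᵐ z ∂D, specNorm z.1.1 ≤ B) {S : Fin m → Sample n (d 0) (d (L + 1))}
    (hS : ∀ i, specNorm (S i).1.1 ≤ B) {V W : Weights (L + 1) d} {u τ : ℝ}
    (hu : ∀ k, specNorm (V k - normalize W k) ≤ u) (hu1 : ((L + 1 : ℕ) : ℝ) * u ≤ 1)
    (hτ : 4 * (((L + 1 : ℕ) : ℝ) * u) * (B + ε) ≤ τ / 2) (hs : 0 < ∏ k, specNorm (W k))
    (hγ : (∏ k, specNorm (W k)) * τ ≤ γ) :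
    robustLoss D ε 0 W - empRobustLoss S ε γ W ≤
      D.real {z | robustMargin ε V z ≤ τ / 2} - (1 / m : ℝ) *
        ∑ i, {z | robustMargin ε V z ≤ τ / 2}.indicator
          (1 : Sample n (d 0) (d (L + 1)) → ℝ) (S i) := by
  classical
  have key : ∀ z : Sample n (d 0) (d (L + 1)), specNorm z.1.1 ≤ B →
      |robustMargin ε V z - robustMargin ε (normalize W) z| ≤ τ / 2 := fun z hz =>
    (abs_robustMargin_sub_le hε hn hK hz (specNorm_normalize_le W) hu hu1).trans hτ
  refine sub_le_sub ?_ ?_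
  · refine ENNReal.toReal_mono (measure_ne_top _ _) (measure_mono_ae ?_)
    filter_upwards [hD] with z hz
    intro (hz0 : robustMargin ε W z ≤ 0)
    show robustMargin ε V z ≤ τ / 2
    rw [robustMargin_eq_prod_mul] at hz0
    have h1 : robustMargin ε (normalize W) z ≤ 0 := by
      by_contra hcon
      exact absurd hz0 (not_le.2 (mul_pos hs (not_le.1 hcon)))
    linarith [(abs_le.1 (key z hz)).2]
  · refine mul_le_mul_of_nonneg_left (Finset.sum_le_sum fun i _ => ?_) (by positivity)
    by_cases hi : robustMargin ε V (S i) ≤ τ / 2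
    · have h1 := (abs_le.1 (key (S i) (hS i))).1
      have h2 : robustMargin ε W (S i) ≤ γ := by
        rw [robustMargin_eq_prod_mul]
        exact (mul_le_mul_of_nonneg_left (by linarith) hs.le).trans hγ
      rw [if_pos h2]
      exact Set.indicator_le_self' (fun _ _ => zero_le_one) _
    · have hi' : S i ∉ {z | robustMargin ε V z ≤ τ / 2} := hi
      rw [Set.indicator_of_notMem hi']
      split_ifs <;> norm_num

/-- Disposes of weights too small for any sample margin to exceed `γ`, so that only `γ < s * (2 * (B
+ ε))` needs a dyadic scale. -/
lemma empRobustLoss_eq_one (hε : 0 ≤ ε) (hn : 1 ≤ n) (hm : 1 ≤ m) (hK : 2 ≤ d (L + 1))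
    {S : Fin m → Sample n (d 0) (d (L + 1))} (hS : ∀ i, specNorm (S i).1.1 ≤ B)
    {W : Weights (L + 1) d} (hγ : (∏ k, specNorm (W k)) * (2 * (B + ε)) ≤ γ) :
    empRobustLoss S ε γ W = 1 := by
  have hm0 : (0 : ℝ) < m := by exact_mod_cast hm
  have h1 : ∀ i, robustMargin ε W (S i) ≤ γ := fun i => by
    rw [robustMargin_eq_prod_mul]
    exact (mul_le_mul_of_nonneg_left (robustMargin_le hε hn hK (hS i) (specNorm_normalize_le W))
      (Finset.prod_nonneg fun k _ => specNorm_nonneg _)).trans hγ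
  simp only [empRobustLoss, h1, if_true, Finset.sum_const, Finset.card_univ, Fintype.card_fin,
    nsmul_eq_mul, mul_one]
  field_simp

/-- Upper and lower bounds on the prior mass, compared on the log scale. In `j + 2`, one unit comes
from the mass `1 / 2` and `j + 1` from the confidence `δ / 2 / 2 ^ j`. -/
lemma mul_sq_le_of_exp_mul_le {a ρ σ : ℝ} (hm : 1 ≤ m) (hδ : 0 < δ) {j : ℕ}
    (hexp : Real.exp (m * a ^ 2 / 4) * (Real.exp (-ρ / (2 * σ ^ 2)) * (1 / 2)) ≤
      m / (δ / 2 / 2 ^ j)) :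
    m * a ^ 2 / 4 ≤ Real.log (m / δ) + (j + 2) * Real.log 2 + ρ / (2 * σ ^ 2) := by
  have hm0 : (0 : ℝ) < m := by exact_mod_cast hm
  have h1 : Real.exp (m * a ^ 2 / 4 - ρ / (2 * σ ^ 2)) ≤ m / δ * 2 ^ (j + 2) := by
    rw [sub_eq_add_neg, Real.exp_add, ← neg_div]
    calc _ = 2 * (Real.exp (m * a ^ 2 / 4) * (Real.exp (-ρ / (2 * σ ^ 2)) * (1 / 2))) := by ring
      _ ≤ 2 * (m / (δ / 2 / 2 ^ j)) := by linarith
      _ = _ := by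
        rw [pow_add]
        field_simp
  have h2 := (Real.le_log_iff_exp_le (by positivity)).2 h1
  rw [Real.log_mul (by positivity) (by positivity), Real.log_pow] at h2
  push_cast at h2
  linarith

lemma div_two_mul_scale_sq {ρ H l t : ℝ} (ht : t ^ 2 = 128 * H) (hH : 0 < H) (hl : 0 < l) (j : ℕ) :
    ρ / (2 * ((1 / 2) ^ j / (4 * l) / t) ^ 2) = ρ * (1024 * H * l ^ 2 * 4 ^ j) := by
  have h3 : (4 : ℝ) ^ j = (2 ^ j) ^ 2 := by
    rw [← pow_mul, mul_comm, pow_mul]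
    norm_num
  have h4 : (1 / 2 : ℝ) ^ j = (2 ^ j)⁻¹ := by rw [one_div, inv_pow]
  rw [div_pow, ht, h3, h4]
  field_simp
  ring

lemma exists_dyadic_scale {s b : ℝ} (hs : 0 < s) (hb : 0 < b) (hγ : 0 < γ)
    (hγs : γ < s * (2 * b)) :
    ∃ j : ℕ, (1 / 2) ^ j * (s * (2 * b)) ≤ γ ∧ γ * 2 ^ j ≤ 4 * (b * s) := by
  have hx0 : 0 < γ / (s * (2 * b)) := by positivity
  obtain ⟨i, hi1, hi2⟩ := exists_nat_pow_near_of_lt_one hx0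
    ((div_le_one (by positivity)).2 hγs.le) (by norm_num : (0 : ℝ) < 1 / 2) (by norm_num)
  rw [lt_div_iff₀ (by positivity)] at hi1
  rw [div_le_iff₀ (by positivity)] at hi2
  -- `i` satisfies `(1/2) ^ (i + 1) < γ / (s * (2 * b)) ≤ (1/2) ^ i`; the finer scale keeps the
  -- rescaled threshold below `γ`.
  refine ⟨i + 1, hi1.le, ?_⟩
  have h1 : (1 / 2 : ℝ) ^ i * 2 ^ i = 1 := by
    rw [← mul_pow]
    norm_num
  calc γ * 2 ^ (i + 1) ≤ (1 / 2) ^ i * (s * (2 * b)) * 2 ^ (i + 1) := by gcongr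
    _ = 4 * (b * s) * ((1 / 2) ^ i * 2 ^ i) := by ring
    _ = _ := by rw [h1, mul_one]

/-- The numerical part of the argument. -/
lemma excess_sq_le {a l H s ρ b Λ : ℝ} {j : ℕ} (hγ : 0 < γ) (hl : 1 ≤ l) (hH : 1 ≤ H)
    (hρ : 1 ≤ ρ) (hjb : γ * 2 ^ j ≤ 4 * (b * s))
    (hΛ : 0 ≤ Λ)
    (ha : m * a ^ 2 / 4 ≤ Λ + (j + 2) * Real.log 2 + ρ * (1024 * H * l ^ 2 * 4 ^ j)) :
    m * a ^ 2 ≤ 90000 * ((b ^ 2 * l ^ 2 * H * (s ^ 2 * ρ) + max 1 (γ ^ 2) * Λ) / γ ^ 2) := by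
  have hγ2 : 0 < γ ^ 2 := by positivity
  have h4 : γ ^ 2 * 4 ^ j ≤ 16 * (b ^ 2 * s ^ 2) := by
    have h5 := pow_le_pow_left₀ (by positivity) hjb 2
    have h6 : (4 : ℝ) ^ j = (2 ^ j) ^ 2 := by
      rw [← pow_mul, mul_comm, pow_mul]
      norm_num
    rw [h6]
    nlinarith
  have hj2 : ((j : ℝ) + 2) * Real.log 2 ≤ 2 * 4 ^ j := by
    have h7 : ((j : ℝ) + 2) ≤ 2 * 4 ^ j := by
      -- Bernoulli: `1 + 3 j ≤ 4 ^ j`. This absorbs the cost of the union over scales.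
      have h8 := one_add_mul_le_pow (a := (3 : ℝ)) (by norm_num) j
      norm_num at h8
      have : (0 : ℝ) ≤ j := Nat.cast_nonneg j
      linarith
    have h9 : Real.log 2 ≤ 1 := by linarith [Real.log_two_lt_d9]
    have : (0 : ℝ) ≤ (j : ℝ) + 2 := by positivity
    nlinarith
  have hX : 1 ≤ ρ * (H * l ^ 2) :=
    one_le_mul_of_one_le_of_one_le hρ (one_le_mul_of_one_le_of_one_le hH (one_le_pow₀ hl))
  have hX4 : (4 : ℝ) ^ j ≤ ρ * (H * l ^ 2) * 4 ^ j := le_mul_of_one_le_left (by positivity) hX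
  -- `4104 = 4 * 1024 + 4 * 2`, and then `16 * 4104 ≤ 90000 = 300²`.
  have h10 : m * a ^ 2 ≤ 4 * Λ + 4104 * (ρ * (H * l ^ 2) * 4 ^ j) := by
    have : ρ * (1024 * H * l ^ 2 * 4 ^ j) = 1024 * (ρ * (H * l ^ 2) * 4 ^ j) := by ring
    linarith
  rw [mul_div_assoc', le_div_iff₀ hγ2]
  have h11 : ρ * (H * l ^ 2) * 4 ^ j * γ ^ 2 ≤ 16 * (b ^ 2 * l ^ 2 * H * (s ^ 2 * ρ)) := by
    calc _ = ρ * (H * l ^ 2) * (γ ^ 2 * 4 ^ j) := by ring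
      _ ≤ ρ * (H * l ^ 2) * (16 * (b ^ 2 * s ^ 2)) :=
        mul_le_mul_of_nonneg_left h4 (by linarith)
      _ = _ := by ring
  have h12 : Λ * γ ^ 2 ≤ max 1 (γ ^ 2) * Λ := by
    rw [mul_comm]
    exact mul_le_mul_of_nonneg_right (le_max_right _ _) hΛ
  have h13 := mul_le_mul_of_nonneg_right h10 hγ2.le
  have h14 : 0 ≤ max 1 (γ ^ 2) * Λ := (mul_nonneg hΛ hγ2.le).trans h12
  have h15 : 0 ≤ ρ * (H * l ^ 2) * 4 ^ j * γ ^ 2 := by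
    have : 0 ≤ ρ * (H * l ^ 2) := by linarith
    positivity
  nlinarith

end Assembly

end RobustGCN

end

/-! ### The generalization bound. -/

open RobustGCN in
theorem mainTheorem2 :
    ∃ C : ℝ, 0 < C ∧
      ∀ (L n m h : ℕ) (d : ℕ → ℕ) (B ε γ δ : ℝ)
        (D : Measure (Sample n (d 0) (d (L + 1)))) [IsProbabilityMeasure D],
        1 ≤ L → 1 ≤ n → 1 ≤ m →
        2 ≤ d (L + 1) → (∀ k ≤ L + 1, d k ≤ h) →
        (∀ᵐ z ∂D, specNorm z.1.1 ≤ B) →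
        0 < ε → 0 < γ → 0 < δ →
        ∃ E : Set (Fin m → Sample n (d 0) (d (L + 1))),
          MeasurableSet E ∧
          1 - δ ≤ (Measure.pi fun _ : Fin m => D).real E ∧
          ∀ S ∈ E, ∀ W : Weights (L + 1) d,
            robustLoss D ε 0 W ≤ empRobustLoss S ε γ W +
              C * Real.sqrt
                (((B + ε) ^ 2 * ((L + 1 : ℕ) : ℝ) ^ 2 * h *
                    Real.log (((L + 1 : ℕ) : ℝ) * h) * Phi W +
                  max 1 (γ ^ 2) * Real.log (m * ((L + 1 : ℕ) : ℝ) / δ)) /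
                (γ ^ 2 * m)) := by
  refine ⟨300, by norm_num, ?_⟩
  intro L n m h d B ε γ δ D _ hL hn hm hK hd hD hε hγ hδ
  -- For `δ ≥ 1` the empty event suffices; afterwards `m l / δ ≥ 2`, so the logarithm is bounded
  -- below.
  rcases le_or_gt 1 δ with hδ1 | hδ1
  · exact ⟨∅, MeasurableSet.empty, by simpa using hδ1, fun S hS => absurd hS (Set.notMem_empty S)⟩
  have hm0 : (0 : ℝ) < m := by exact_mod_cast hm
  have hm1 : (1 : ℝ) ≤ m := by exact_mod_cast hm
  have hh : 2 ≤ h := hK.trans (hd _ le_rfl)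
  have hh2 : (2 : ℝ) ≤ h := by exact_mod_cast hh
  have hB : 0 < B + ε := by
    obtain ⟨z, hz⟩ := hD.exists
    linarith [specNorm_nonneg z.1.1]
  have hrad := union_bound_radius hL hh
  obtain ⟨l, hl⟩ : ∃ l : ℝ, l = ((L + 1 : ℕ) : ℝ) := ⟨_, rfl⟩
  have hl2 : 2 ≤ l := by rw [hl]; exact_mod_cast Nat.succ_le_succ hL
  obtain ⟨H, hH⟩ : ∃ H : ℝ, H = h * Real.log (l * h) := ⟨_, rfl⟩
  have hH1 : 1 ≤ H := by
    have := one_le_log_of_four_le (show 4 ≤ l * h by nlinarith)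
    rw [hH]
    nlinarith
  rw [← hl, ← hH] at hrad
  obtain ⟨t, ht⟩ : ∃ t : ℝ, t = Real.sqrt (128 * H) := ⟨_, rfl⟩
  have ht0 : 0 < t := ht ▸ Real.sqrt_pos.2 (by linarith)
  have ht2 : t ^ 2 = 128 * H := by rw [ht, Real.sq_sqrt (by linarith)]
  rw [← ht2, hl] at hrad
  -- Chosen so that `4 l u_j (B + ε)` is exactly half of the threshold `τ_j = (1/2) ^ j * (2 * (B +
  -- ε))`; then `σ_j` is the prior scale whose typical spectral radius `σ_j t` equals `u_j`.
  let u : ℕ → ℝ := fun j => (1 / 2) ^ j / (4 * l)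
  let σ : ℕ → ℝ := fun j => u j / t
  have hu0 : ∀ j, 0 < u j := fun j => by positivity
  have hσ0 : ∀ j, 0 < σ j := fun j => div_pos (hu0 j) ht0
  have hσt : ∀ j, σ j * t = u j := fun j => div_mul_cancel₀ _ ht0.ne'
  have hlu : ∀ j, ((L + 1 : ℕ) : ℝ) * u j = (1 / 2) ^ j / 4 := fun j => by
    rw [← hl]
    simp only [u]
    field_simp
  have hPm : MeasurableSet {z : Sample n (d 0) (d (L + 1)) | specNorm z.1.1 ≤ B} :=
    measurableSet_le (continuous_specNorm.measurable.comp (measurable_fst.comp measurable_fst))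
      measurable_const
  obtain ⟨E, hEm, hEμ, hE⟩ := exists_uniform_deviation_family
    (stdGauss (WeightIdx (L + 1) d)) D
    (fun j => measurableSet_robustMargin_le hε.le hn hK (σ j) ((1 / 2) ^ j * (2 * (B + ε)) / 2))
    hPm hD hm hδ
  refine ⟨E, hEm, hEμ, ?_⟩
  intro S hSE W
  have hS₀ : ∀ i, specNorm (S i).1.1 ≤ B := (hE S hSE).1
  have hdevS := (hE S hSE).2
  rw [← sub_le_iff_le_add', ← hl, mul_assoc ((B + ε) ^ 2 * l ^ 2), ← hH]
  obtain ⟨a, ha⟩ : ∃ a, a = robustLoss D ε 0 W - empRobustLoss S ε γ W := ⟨_, rfl⟩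
  rw [← ha]
  have hloss : robustLoss D ε 0 W ≤ 1 := measureReal_le_one
  obtain ⟨s, hs⟩ : ∃ s, s = ∏ k, specNorm (W k) := ⟨_, rfl⟩
  have hs0 : 0 ≤ s := hs ▸ Finset.prod_nonneg fun k _ => specNorm_nonneg _
  have hlog2 : Real.log 2 ≤ Real.log (m * l / δ) := by
    refine Real.log_le_log (by norm_num) ?_
    rw [le_div_iff₀ hδ]
    nlinarith
  have hlog : 1 / 2 ≤ Real.log (m * l / δ) := by linarith [Real.log_two_gt_d9]
  rcases le_or_gt (s * (2 * (B + ε))) γ with hγs | hγs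
  · rw [hs] at hγs
    have h1 := empRobustLoss_eq_one hε.le hn hm hK hS₀ hγs
    exact le_trans (by linarith) (mul_nonneg (by norm_num) (Real.sqrt_nonneg _))
  have hspos : 0 < s := by
    refine hs0.lt_of_ne fun h0 => ?_
    rw [← h0, zero_mul] at hγs
    exact lt_asymm hγ hγs
  have hW0 : ∀ k, specNorm (W k) ≠ 0 := fun k hk =>
    hspos.ne' (hs.trans (Finset.prod_eq_zero (Finset.mem_univ k) hk))
  obtain ⟨ρ, hρ⟩ : ∃ ρ, ρ = ∑ k, frobNorm (normalize W k) ^ 2 := ⟨_, rfl⟩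
  have hρ1 : 1 ≤ ρ := hρ ▸ one_le_sum_frobNorm_normalize hW0
  rw [Phi_eq_prod_mul_sum, ← hs, ← hρ]
  obtain ⟨Y, hY⟩ : ∃ Y, Y = (B + ε) ^ 2 * l ^ 2 * H * (s ^ 2 * ρ) +
    max 1 (γ ^ 2) * Real.log (m * l / δ) := ⟨_, rfl⟩
  rw [← hY]
  suffices hmain : m * a ^ 2 ≤ 90000 * (Y / γ ^ 2) ∨ a ≤ 0 by
    rcases hmain with hmain | hneg
    · have h1 : a ^ 2 ≤ 300 ^ 2 * (Y / (γ ^ 2 * m)) := by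
        rw [← div_div, mul_div_assoc', le_div_iff₀ hm0]
        linarith
      calc a ≤ Real.sqrt (a ^ 2) := Real.le_sqrt_of_sq_le le_rfl
        _ ≤ Real.sqrt (300 ^ 2 * (Y / (γ ^ 2 * m))) := Real.sqrt_le_sqrt h1
        _ = _ := by rw [Real.sqrt_mul (by norm_num), Real.sqrt_sq (by norm_num)]
    · exact hneg.trans (mul_nonneg (by norm_num) (Real.sqrt_nonneg _))
  rcases le_or_gt a 0 with ha0 | ha0
  · exact Or.inr ha0
  left
  -- Below `1 / m` the deviation bound is unavailable, but there `m a² ≤ 1` and the confidence term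
  -- alone suffices, thanks to the `γ ^ 2` inside the maximum.
  rcases lt_or_ge (m * a) 1 with hma | hma
  · have h1 : 1 / 2 * γ ^ 2 ≤ Y := by
      have h2 : γ ^ 2 * (1 / 2) ≤ max 1 (γ ^ 2) * Real.log (m * l / δ) := by
        gcongr
        exact le_max_right _ _
      have h3 : 0 ≤ (B + ε) ^ 2 * l ^ 2 * H * (s ^ 2 * ρ) := by positivity
      linarith
    have h4 : 1 / 2 ≤ Y / γ ^ 2 := (le_div_iff₀ (by positivity)).2 h1
    have h5 : a ≤ 1 := by nlinarith
    nlinarith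
  have ha1 : a ≤ 1 := by
    have : 0 ≤ empRobustLoss S ε γ W := by
      refine mul_nonneg (by positivity) (Finset.sum_nonneg fun i _ => ?_)
      split_ifs <;> norm_num
    linarith
  obtain ⟨j, hj1, hj2⟩ := exists_dyadic_scale hspos hB hγ hγs
  have hpow : (1 / 2 : ℝ) ^ j ≤ 1 := pow_le_one₀ (by norm_num) (by norm_num)
  have hmass := le_stdGauss_neighbourhood hd ht0 hrad (hσ0 j) (normalize W)
  rw [← hρ, hσt] at hmass
  have hnear : ∀ ω : WeightIdx (L + 1) d → ℝ,
      (∀ k, specNorm (toWeights (σ j • ω) k - normalize W k) ≤ u j) →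
      a ≤ D.real {z | robustMargin ε (toWeights (σ j • ω)) z ≤
          (1 / 2) ^ j * (2 * (B + ε)) / 2} - (1 / m : ℝ) *
        ∑ i, {z | robustMargin ε (toWeights (σ j • ω)) z ≤
          (1 / 2) ^ j * (2 * (B + ε)) / 2}.indicator
            (1 : Sample n (d 0) (d (L + 1)) → ℝ) (S i) := by
    intro ω hω
    rw [ha]
    refine excess_le_of_near hε.le hn hK D hD hS₀ hω ?_ ?_ (hs ▸ hspos) ?_
    · rw [hlu]
      linarith
    · rw [hlu]
      linarith
    · rw [← hs]
      linarith
  have hdev := hdevS j _ a hma ha1 hnear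
  have hexp := (mul_le_mul_of_nonneg_left hmass (Real.exp_pos _).le).trans hdev
  have hbound := mul_sq_le_of_exp_mul_le hm hδ hexp
  rw [hY]
  have h1 : Real.log (m / δ) ≤ Real.log (m * l / δ) :=
    Real.log_le_log (by positivity) (div_le_div_of_nonneg_right
      (le_mul_of_one_le_right hm0.le (by linarith)) hδ.le)
  have h2 : ρ / (2 * σ j ^ 2) = ρ * (1024 * H * l ^ 2 * 4 ^ j) :=
    div_two_mul_scale_sq ht2 (by linarith) (by linarith) j
  rw [h2] at hbound
  exact excess_sq_le hγ (by linarith) hH1 hρ1 hj2 (by linarith) (hbound.trans (by linarith))
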